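/- Let $0\le k$, $0\le n$, $[n]=\{1,\dots,n\}$, and let $R(k,n)=\mathbb{C}[\Delta_I : I\in\binom{[n]}{k}]/(\text{Plücker relations})$ be the homogeneous coordinate ring of the Grassmannian, with degree two piece $R(k,n)_2$ spanned by the products $\Delta_I\Delta_J$. A $(k,n)$-partial noncrossing pairing $(\tau,T)$ is a noncrossing perfect pairing $\tau$ of a subset $S\subset[n]$ together with a subset $T\subset[n]\setminus S$, such that $2|T|+|S|=2k$; the elements $(a,b)$, $a<b$, of $\tau$ are called strands. A pair $(I,J)$ of $k$-subsets of $[n]$ is compatible with $(\tau,T)$ if $I\cap J=T$ and each strand of $\tau$ contains one element of $I$ and one element of $J$. The Temperley–Lieb invariants $\Delta_{(\tau,T)}\in R(k,n)_2$ are the elements determined uniquely by the identities $\Delta_I\Delta_J=\sum\Delta_{(\tau,T)}$, for all $I,J\in\binom{[n]}{k}$, where the sum is over all $(\tau,T)$ compatible with $(I,J)$. A pair $(I,J)$ of $k$-subsets is standard if $I=\{i_1<\dots<i_k\}$ and $J=\{j_1<\dots<j_k\}$ satisfy $i_r\le j_r$ for all $r$, that is, if $I$ and $J$ are the two columns of a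 semistandard tableau. Let $\theta$ be the bijection from $(k,n)$-partial noncrossing pairings to standard pairs given by $\theta(\tau,T)=(I_1,I_2)$, where $I_1$ (respectively $I_2$) consists of $T$ and the smaller (respectively larger) ends of the strands of $\tau$. For a standard pair $(I,J)$ let $\tau(I,J)$ be the pairing in $\theta^{-1}(I,J)=(\tau(I,J),I\cap J)$. For a sequence $\mathbf I=(i_1,\dots,i_k)$ of distinct elements of $[n]$ with underlying set $\bar{\mathbf I}$ and a $k$-subset $J$ such that $(\bar{\mathbf I},J)$ is standard, write $(\mathbf I,J)\to_a(\mathbf I',J')$ if $(i_a,j)\in\tau(\bar{\mathbf I},J)$ for some $j$, $\mathbf I'$ is $\mathbf I$ with $i_a$ replaced by $j$, $J'=(J\setminus\{j\})\cup\{i_a\}$, and $(\bar{\mathbf I}',J')$ is standard. A legal path $P$ of length $|P|=r\ge0$ from $(I,J)$ to $(K,L)$ is a sequence $$(\mathbf I_0,J_0)\to_{a_1}(\mathbf I_1,J_1)\to_{a_2}\cdots\to_{a_r}(\mathbf I_r,J_r)$$ where $\mathbf I_0$ is $I$ arranged in increasing order, $J_0=J$, $\bar{\mathbf I}_r=K$,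 $J_r=L$, and $a_1\ge a_2\ge\dots\ge a_r$. Theorem. The elements $\Delta_{(\tau,T)}$ exist and are unique, and for every $(k,n)$-partial noncrossing pairing $(\tau,T)$, $$\Delta_{(\tau,T)}=\sum_{(I,J)}\Big(\sum_P(-1)^{|P|}\Big)\Delta_I\Delta_J,$$ where the first sum is over all standard pairs $(I,J)$ and the second is over all (finitely many) legal paths $P$ from $(I,J)$ to $\theta(\tau,T)$. -/

import Mathlib

open scoped BigOperators

/-- `k`-element subsets of `[n]`; the set `[n]` is modelled by `Fin n`. -/
abbrev KSubset (k n : ℕ) : Type := {I : Finset (Fin n) // I.card = k}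

/-! ### The homogeneous coordinate ring of the Grassmannian -/

/-- The set of entries of a sequence of `k` distinct elements of `[n]`. -/
def seqSet {k n : ℕ} (f : Fin k ↪ Fin n) : KSubset k n :=
  ⟨Finset.univ.map f, by simp⟩

open Classical in
/-- The symbol `Δ_{f 0, …, f (k-1)}` of a sequence of elements of `[n]`, as an element of the
polynomial ring on the `Δ_I`: it is alternating, so it is `0` if the sequence has a repetition, and
otherwise the sign of the permutation sorting the sequence times the variable `Δ_I` of its set `I`
of entries. -/
noncomputable def pluckerSymbol {k n : ℕ} (f : Fin k → Fin n) :
    MvPolynomial (KSubset k n) ℂ :=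
  if h : Function.Injective f then
    (((Equiv.Perm.sign (Tuple.sort f) : ℤˣ) : ℤ) : MvPolynomial (KSubset k n) ℂ) *
      MvPolynomial.X (seqSet ⟨f, h⟩)
  else 0

/-- The Plücker relation that exchanges the entry of the sequence `f` in position `s` with each
entry of the sequence `g` in turn:
`Δ_f Δ_g - ∑_t Δ_{f with f_s replaced by g_t} Δ_{g with g_t replaced by f_s}`. -/
noncomputable def pluckerRelation {k n : ℕ} (f g : Fin k → Fin n) (s : Fin k) :
    MvPolynomial (KSubset k n) ℂ :=
  pluckerSymbol f * pluckerSymbol g -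
    ∑ t : Fin k, pluckerSymbol (Function.update f s (g t)) *
      pluckerSymbol (Function.update g t (f s))

/-- The ideal generated by the Plücker relations. -/
noncomputable def pluckerIdeal (k n : ℕ) : Ideal (MvPolynomial (KSubset k n) ℂ) :=
  Ideal.span {x | ∃ (f g : Fin k → Fin n) (s : Fin k), x = pluckerRelation f g s}

/-- The ring `R(k,n) = ℂ[Δ_I] / (Plücker relations)`. -/
abbrev PluckerRing (k n : ℕ) : Type :=
  MvPolynomial (KSubset k n) ℂ ⧸ pluckerIdeal k n

/-- The Plücker coordinate `Δ_I ∈ R(k,n)`. -/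
noncomputable def pluckerCoord {k n : ℕ} (I : KSubset k n) : PluckerRing k n :=
  Ideal.Quotient.mk (pluckerIdeal k n) (MvPolynomial.X I)

/-- The degree two piece `R(k,n)₂`, spanned by the products `Δ_I Δ_J`. -/
noncomputable def pluckerDegreeTwo (k n : ℕ) : Submodule ℂ (PluckerRing k n) :=
  Submodule.span ℂ {x | ∃ I J : KSubset k n, x = pluckerCoord I * pluckerCoord J}

/-! ### Partial noncrossing pairings -/

/-- A `(k,n)`-partial noncrossing pairing `(τ,T)`: `strands` is `τ`, each strand `{a < b}` being
stored as `(a, b)`, and `marked` is `T`. The paired vertices form the set `S`, which has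
`2 * strands.card` elements because distinct strands have no common end. -/
@[ext]
structure PartialPairing (k n : ℕ) where
  strands : Finset (Fin n × Fin n)
  marked : Finset (Fin n)
  strand_lt : ∀ p ∈ strands, p.1 < p.2
  strands_disjoint : ∀ p ∈ strands, ∀ q ∈ strands, p ≠ q →
    p.1 ≠ q.1 ∧ p.1 ≠ q.2 ∧ p.2 ≠ q.1 ∧ p.2 ≠ q.2
  noncrossing : ∀ p ∈ strands, ∀ q ∈ strands, ¬ (p.1 < q.1 ∧ q.1 < p.2 ∧ p.2 < q.2)
  unmarked : ∀ p ∈ strands, p.1 ∉ marked ∧ p.2 ∉ marked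
  card_eq : 2 * marked.card + 2 * strands.card = 2 * k

noncomputable instance {k n : ℕ} : Fintype (PartialPairing k n) :=
  Fintype.ofInjective (fun p => (p.strands, p.marked)) fun _ _ h =>
    PartialPairing.ext (congrArg Prod.fst h) (congrArg Prod.snd h)

namespace PartialPairing

variable {k n : ℕ}

/-- `(I,J)` is compatible with `(τ,T)`: `I ∩ J = T`, and each strand of `τ` joins an element of
`I` and an element of `J`. -/
def Compatible (p : PartialPairing k n) (I J : KSubset k n) : Prop :=
  I.1 ∩ J.1 = p.marked ∧
    ∀ s ∈ p.strands, (s.1 ∈ I.1 ∧ s.2 ∈ J.1) ∨ (s.1 ∈ J.1 ∧ s.2 ∈ I.1)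

instance (p : PartialPairing k n) (I J : KSubset k n) : Decidable (p.Compatible I J) :=
  inferInstanceAs (Decidable (_ ∧ _))

/-- The first column of `θ(τ,T)`: the marked vertices and the smaller ends of the strands. -/
def firstColumn (p : PartialPairing k n) : KSubset k n :=
  ⟨p.marked ∪ p.strands.image Prod.fst, by
    rw [Finset.card_union_of_disjoint, Finset.card_image_of_injOn]
    · have := p.card_eq
      omega
    · intro a ha b hb h
      by_contra hne
      exact (p.strands_disjoint a ha b hb hne).1 h
    · rw [Finset.disjoint_left]
      intro x hx hx'
      obtain ⟨s, hs, rfl⟩ := Finset.mem_image.1 hx'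
      exact (p.unmarked s hs).1 hx⟩

/-- The second column of `θ(τ,T)`: the marked vertices and the larger ends of the strands. -/
def secondColumn (p : PartialPairing k n) : KSubset k n :=
  ⟨p.marked ∪ p.strands.image Prod.snd, by
    rw [Finset.card_union_of_disjoint, Finset.card_image_of_injOn]
    · have := p.card_eq
      omega
    · intro a ha b hb h
      by_contra hne
      exact (p.strands_disjoint a ha b hb hne).2.2.2 h
    · rw [Finset.disjoint_left]
      intro x hx hx'
      obtain ⟨s, hs, rfl⟩ := Finset.mem_image.1 hx'
      exact (p.unmarked s hs).2 hx⟩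

/-- The pair of columns of the tableau `θ(τ,T)`. -/
def theta (p : PartialPairing k n) : KSubset k n × KSubset k n :=
  (p.firstColumn, p.secondColumn)

end PartialPairing

/-! ### Temperley–Lieb invariants -/

/-- The family `Δ_(τ,T)` of elements of `R(k,n)₂` satisfies
`Δ_I Δ_J = ∑_{(τ,T) compatible with (I,J)} Δ_(τ,T)` for all `I` and `J`. This is the property that
determines the Temperley–Lieb invariants. -/
def IsTemperleyLieb {k n : ℕ} (D : PartialPairing k n → PluckerRing k n) : Prop :=
  (∀ p, D p ∈ pluckerDegreeTwo k n) ∧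
    ∀ I J : KSubset k n, pluckerCoord I * pluckerCoord J =
      ∑ p : PartialPairing k n with p.Compatible I J, D p

/-! ### Standard pairs and legal paths -/

/-- `(I,J)` is standard: `I` and `J`, written in increasing order, are the first and second column
of a semistandard tableau. -/
def IsStandard {k n : ℕ} (I J : KSubset k n) : Prop :=
  ∀ r : Fin k, I.1.orderEmbOfFin I.2 r ≤ J.1.orderEmbOfFin J.2 r

instance {k n : ℕ} (I J : KSubset k n) : Decidable (IsStandard I J) :=
  inferInstanceAs (Decidable (∀ _, _))

/-- A pair `(𝐈,J)` of a sequence `𝐈` of `k` distinct elements of `[n]` and a `k`-subset `J`. -/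
abbrev PathState (k n : ℕ) : Type := (Fin k ↪ Fin n) × KSubset k n

/-- `(x,y)` is a strand of the matching `τ(I,J)` of `θ⁻¹(I,J)`. -/
def IsStrand {k n : ℕ} (I J : KSubset k n) (x y : Fin n) : Prop :=
  ∃ p : PartialPairing k n, p.theta = (I, J) ∧ (x, y) ∈ p.strands

/-- The step `(𝐈,J) →_a (𝐈',J')`: the entry `i_a` of `𝐈` is swapped with the element `j` of `J`,
where `(i_a,j)` is a strand of `τ(𝐈,J)`, and the resulting pair is standard. -/
def PathStep {k n : ℕ} (a : Fin k) (x y : PathState k n) : Prop :=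
  ∃ j : Fin n, IsStrand (seqSet x.1) x.2 (x.1 a) j ∧
    (y.1 : Fin k → Fin n) = Function.update x.1 a j ∧
    y.2.1 = insert (x.1 a) (x.2.1.erase j) ∧
    IsStandard (seqSet y.1) y.2

/-- A legal path from the pair `A = (I,J)` to the pair `B = (K,L)`: it starts at `(𝐈₀,J)`, where
`𝐈₀` is `I` in increasing order, each step is a step `→_a`, the labels `a` are weakly decreasing,
and the underlying pair of sets of its last state is `(K,L)`. -/
@[ext]
structure LegalPath {k n : ℕ} (A B : KSubset k n × KSubset k n) where
  length : ℕ
  state : Fin (length + 1) → PathState k n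
  label : Fin length → Fin k
  start : state 0 = ((A.1.1.orderEmbOfFin A.1.2).toEmbedding, A.2)
  step : ∀ i : Fin length, PathStep (label i) (state i.castSucc) (state i.succ)
  antitone : Antitone label
  finish : (seqSet (state (Fin.last length)).1, (state (Fin.last length)).2) = B

/-- Each step makes the sum of the entries of the sequence larger. -/
lemma PathStep.sum_lt {k n : ℕ} {a : Fin k} {x y : PathState k n} (h : PathStep a x y) :
    ∑ i, (x.1 i : ℕ) < ∑ i, (y.1 i : ℕ) := by
  obtain ⟨j, ⟨p, -, hp⟩, hy, -, -⟩ := h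
  have hlt : x.1 a < j := p.strand_lt _ hp
  rw [hy]
  refine Finset.sum_lt_sum (fun i _ => ?_) ⟨a, Finset.mem_univ a, by simpa using hlt⟩
  by_cases hi : i = a
  · subst hi
    simpa using hlt.le
  · simp [Function.update_of_ne hi]

lemma LegalPath.length_lt {k n : ℕ} {A B : KSubset k n × KSubset k n} (P : LegalPath A B) :
    P.length < Fintype.card (PathState k n) := by
  have hmono : StrictMono fun i => ∑ r, ((P.state i).1 r : ℕ) :=
    Fin.strictMono_iff_lt_succ.2 fun i => (P.step i).sum_lt
  have hinj : Function.Injective P.state := fun i j h => hmono.injective (by simp only [h])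
  simpa [Nat.succ_le_iff] using Fintype.card_le_of_injective _ hinj

/-- There are finitely many legal paths between two given pairs. -/
instance {k n : ℕ} (A B : KSubset k n × KSubset k n) : Finite (LegalPath A B) := by
  let F : LegalPath A B → (Σ r : Fin (Fintype.card (PathState k n)),
      (Fin (r.1 + 1) → PathState k n) × (Fin r.1 → Fin k)) :=
    fun P => ⟨⟨P.length, P.length_lt⟩, P.state, P.label⟩
  refine Finite.of_injective F ?_
  rintro ⟨r, s, l, _, _, _, _⟩ ⟨r', s', l', _, _, _, _⟩ h
  simp only [F, Sigma.mk.injEq, Fin.mk.injEq] at h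
  obtain ⟨rfl, h⟩ := h
  simp only [heq_eq_eq, Prod.mk.injEq] at h
  obtain ⟨rfl, rfl⟩ := h
  rfl

noncomputable instance {k n : ℕ} (A B : KSubset k n × KSubset k n) : Fintype (LegalPath A B) :=
  Fintype.ofFinite _

/-- The signed number `∑_P (-1)^|P|` of legal paths from `A` to `B`. -/
noncomputable def signedPathCount {k n : ℕ} (A B : KSubset k n × KSubset k n) : ℤ :=
  ∑ P : LegalPath A B, (-1) ^ P.length

/-!
The pairing `θ⁻¹(I, J)` is the parenthesis matching of a standard pair, so `θ` is a bijection between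
pairings and standard pairs, and the statement is about inverting the square matrix
`M(A, p) = [A is compatible with p]`, indexed by standard pairs `A` and pairings `p`.

**The inverse of `M`.** The pairs compatible with `p` are its orientations, i.e. the results of
reversing some strands. Call an orientation of (the pairing of) a state `(𝐈, J)` one that keeps the
labels `< m` if it does not reverse the strands starting at entries with those labels. Reversing a
strand `(x, y)` that lies immediately inside a strand `(e, f)` turns `(I, J)` into a standard pair
whose pairing has `(e, x)` and `(y, f)` instead. Hence, if `e` is kept, then reversing `(x, y)` in the
old pairing amounts to keeping `(y, f)` in the new one (`IsSwap.compatible_iff`), whereas a strand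
that is not nested cannot be reversed in a standard orientation. This gives a recursion for
orientations (`orientation_recursion`) which matches the splitting of paths by their first label
(`BoundedPath.bijective_split`), with opposite sign. So the signed sum over all legal paths from `B`
of the orientations of their ends telescopes to the orientations of `B` that keep everything, that
is, to `B` itself (`sum_compatible_signedPathCount`). The recursion needs that `e` has a smaller
label than `x`; this is where the weakly decreasing order of the labels is used (`Admissible`).
Uniqueness and the formula follow from this alone.

**Existence.** Define `Δ_(τ,T)` by the formula. The identities then hold for standard pairs, and both
sides satisfy the Plücker relations: the right-hand side because the terms in which a given pairing
occurs cancel in pairs, along the strands (`sum_sign_compatible_eq_zero`). By a straightening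
argument in characteristic zero, a function with these relations is determined by its values on
standard pairs (`IsPlucker.eq_zero`).
-/

/-! ### Strands and compatibility -/

namespace PartialPairing

variable {k n : ℕ}

/-- `x` and `y` are the two ends of a strand of `p`, in either order. -/
def Joined (p : PartialPairing k n) (x y : Fin n) : Prop :=
  (x, y) ∈ p.strands ∨ (y, x) ∈ p.strands

lemma Joined.symm {p : PartialPairing k n} {x y : Fin n} (h : p.Joined x y) : p.Joined y x :=
  Or.symm h

lemma Joined.unique {p : PartialPairing k n} {x y z : Fin n} (h : p.Joined x y)
    (h' : p.Joined x z) : y = z := by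
  rcases h with h | h <;> rcases h' with h' | h'
  · by_contra hne
    exact (p.strands_disjoint _ h _ h' (by simpa using hne)).1 rfl
  · have hlt := p.strand_lt _ h
    have hlt' := p.strand_lt _ h'
    refine absurd rfl (p.strands_disjoint _ h _ h' ?_).2.1
    rintro heq
    simp only [Prod.mk.injEq] at heq hlt hlt'
    omega
  · have hlt := p.strand_lt _ h
    have hlt' := p.strand_lt _ h'
    refine absurd rfl (p.strands_disjoint _ h _ h' ?_).2.2.1
    rintro heq
    simp only [Prod.mk.injEq] at heq hlt hlt'
    omega
  · by_contra hne
    exact (p.strands_disjoint _ h _ h' (by simpa using hne)).2.2.2 rfl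

lemma Joined.not_mem_marked {p : PartialPairing k n} {x y : Fin n} (h : p.Joined x y) :
    x ∉ p.marked := by
  rcases h with h | h
  · exact (p.unmarked _ h).1
  · exact (p.unmarked _ h).2

lemma fst_ne_snd (p : PartialPairing k n) {x y z : Fin n} (h : (x, y) ∈ p.strands)
    (h' : (z, x) ∈ p.strands) : False := by
  have hlt := p.strand_lt _ h
  have hlt' := p.strand_lt _ h'
  have : y = z := Joined.unique (p := p) (x := x) (Or.inl h) (Or.inr h')
  subst this
  exact absurd (hlt.trans hlt') (lt_irrefl _)

lemma mem_firstColumn {p : PartialPairing k n} {x : Fin n} :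
    x ∈ p.firstColumn.1 ↔ x ∈ p.marked ∨ ∃ y, (x, y) ∈ p.strands := by
  simp [firstColumn]

lemma mem_secondColumn {p : PartialPairing k n} {x : Fin n} :
    x ∈ p.secondColumn.1 ↔ x ∈ p.marked ∨ ∃ y, (y, x) ∈ p.strands := by
  simp [secondColumn]

lemma Compatible.symm {p : PartialPairing k n} {I J : KSubset k n} (h : p.Compatible I J) :
    p.Compatible J I :=
  ⟨by rw [Finset.inter_comm]; exact h.1, fun s hs => (h.2 s hs).symm⟩

lemma compatible_theta (p : PartialPairing k n) : p.Compatible p.firstColumn p.secondColumn := by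
  refine ⟨?_, fun s hs => Or.inl ⟨mem_firstColumn.2 (Or.inr ⟨s.2, hs⟩),
    mem_secondColumn.2 (Or.inr ⟨s.1, hs⟩)⟩⟩
  ext x
  rw [Finset.mem_inter, mem_firstColumn, mem_secondColumn]
  constructor
  · rintro ⟨h | ⟨y, h⟩, h' | ⟨z, h'⟩⟩
    · exact h
    · exact h
    · exact h'
    · exact (p.fst_ne_snd h h').elim
  · exact fun h => ⟨Or.inl h, Or.inl h⟩

lemma Compatible.not_mem_both {p : PartialPairing k n} {I J : KSubset k n}
    (h : p.Compatible I J) {x y : Fin n} (hxy : p.Joined x y) (hI : x ∈ I.1) (hJ : x ∈ J.1) :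
    False :=
  hxy.not_mem_marked (h.1 ▸ Finset.mem_inter.2 ⟨hI, hJ⟩)

/-- The strands use up all of `I \ J`: there are `k - |T|` strands, each with exactly one end
in `I`. -/
lemma Compatible.exists_joined {p : PartialPairing k n} {I J : KSubset k n}
    (h : p.Compatible I J) {x : Fin n} (hx : x ∈ I.1) (hT : x ∉ p.marked) :
    ∃ y ∈ J.1, p.Joined x y := by
  classical
  let e : Fin n × Fin n → Fin n := fun s => if s.1 ∈ I.1 then s.1 else s.2
  have he : ∀ s ∈ p.strands, e s ∈ I.1 ∧ ∃ y ∈ J.1, p.Joined (e s) y := by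
    intro s hs
    by_cases h1 : s.1 ∈ I.1
    · have he : e s = s.1 := if_pos h1
      rw [he]
      refine ⟨h1, s.2, ?_, Or.inl hs⟩
      rcases h.2 s hs with h2 | h2
      · exact h2.2
      · exact (h.not_mem_both (Or.inl hs : p.Joined s.1 s.2) h1 h2.1).elim
    · have he : e s = s.2 := if_neg h1
      rw [he]
      rcases h.2 s hs with h2 | h2
      · exact (h1 h2.1).elim
      · exact ⟨h2.2, s.1, h2.1, Or.inr hs⟩
  have hinj : Set.InjOn e p.strands := by
    intro s hs t ht hst
    by_contra hne
    obtain ⟨h1, h2, h3, h4⟩ := p.strands_disjoint s hs t ht hne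
    simp only [e] at hst
    split_ifs at hst <;> contradiction
  have hsub : p.strands.image e ⊆ I.1 \ p.marked := by
    intro z hz
    obtain ⟨s, hs, rfl⟩ := Finset.mem_image.1 hz
    obtain ⟨h1, y, -, h2⟩ := he s hs
    exact Finset.mem_sdiff.2 ⟨h1, h2.not_mem_marked⟩
  have hmI : p.marked ⊆ I.1 := h.1 ▸ Finset.inter_subset_left
  have hcard : (I.1 \ p.marked).card ≤ (p.strands.image e).card := by
    rw [Finset.card_image_of_injOn hinj, Finset.card_sdiff_of_subset hmI, I.2]
    have := p.card_eq
    omega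
  have heq := Finset.eq_of_subset_of_card_le hsub hcard
  have hx' : x ∈ p.strands.image e := heq ▸ Finset.mem_sdiff.2 ⟨hx, hT⟩
  obtain ⟨s, hs, rfl⟩ := Finset.mem_image.1 hx'
  exact (he s hs).2

lemma Compatible.card_filter_le {p : PartialPairing k n} {I J : KSubset k n}
    (h : p.Compatible I J) (U : Fin n → Prop) [DecidablePred U]
    (hU : ∀ x y, p.Joined x y → x ∈ I.1 → U x → U y) :
    (I.1.filter U).card ≤ (J.1.filter U).card := by
  refine Finset.card_le_card_of_forall_subsingleton
    (fun x y => (x ∈ p.marked ∧ x = y) ∨ p.Joined x y) (fun x hx => ?_) (fun y hy => ?_)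
  · obtain ⟨hxI, hxU⟩ := Finset.mem_filter.1 hx
    by_cases hT : x ∈ p.marked
    · have : x ∈ J.1 := Finset.inter_subset_right (h.1.symm ▸ hT)
      exact ⟨x, Finset.mem_filter.2 ⟨this, hxU⟩, Or.inl ⟨hT, rfl⟩⟩
    · obtain ⟨y, hy, hxy⟩ := h.exists_joined hxI hT
      exact ⟨y, Finset.mem_filter.2 ⟨hy, hU x y hxy hxI hxU⟩, Or.inr hxy⟩
  · rintro a ⟨-, ha⟩ b ⟨-, hb⟩
    rcases ha with ⟨ha, rfl⟩ | ha <;> rcases hb with ⟨hb, hb'⟩ | hb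
    · exact hb'.symm
    · exact (hb.symm.not_mem_marked ha).elim
    · exact (ha.symm.not_mem_marked (hb' ▸ hb)).elim
    · exact ha.symm.unique hb.symm

/-- A set of vertices that contains both ends or no end of each strand meets `I` and `J` in equally
many elements. -/
lemma Compatible.card_filter_eq {p : PartialPairing k n} {I J : KSubset k n}
    (h : p.Compatible I J) (U : Fin n → Prop) [DecidablePred U]
    (hU : ∀ x y, p.Joined x y → U x → U y) :
    (I.1.filter U).card = (J.1.filter U).card :=
  le_antisymm (h.card_filter_le U fun x y hxy _ => hU x y hxy)
    (h.symm.card_filter_le U fun x y hxy _ => hU x y hxy)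

end PartialPairing

/-! ### Standard pairs and the bijection `θ` -/

/-- Standardness is the ballot condition: every initial segment of `[n]` has at least as many
elements of `I` as of `J`. -/
lemma isStandard_iff {k n : ℕ} {I J : KSubset k n} :
    IsStandard I J ↔ ∀ x : Fin n, (J.1.filter (· ≤ x)).card ≤ (I.1.filter (· ≤ x)).card := by
  have key : ∀ (K : KSubset k n) (x : Fin n), (K.1.filter (· ≤ x)).card =
      (Finset.univ.filter fun r : Fin k => K.1.orderEmbOfFin K.2 r ≤ x).card := by
    intro K x
    conv_lhs => rw [← Finset.map_orderEmbOfFin_univ K.1 K.2]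
    rw [Finset.filter_map, Finset.card_map]
    rfl
  constructor
  · intro h x
    rw [key, key]
    refine Finset.card_le_card fun r hr => ?_
    simp only [Finset.mem_filter, Finset.mem_univ, true_and] at hr ⊢
    exact (h r).trans hr
  · intro h r
    by_contra hlt
    rw [not_le] at hlt
    have h1 := h (J.1.orderEmbOfFin J.2 r)
    rw [key, key] at h1
    have h2 : (Finset.univ.filter fun s : Fin k =>
        I.1.orderEmbOfFin I.2 s ≤ J.1.orderEmbOfFin J.2 r) ⊆ Finset.Iio r := by
      intro s hs
      simp only [Finset.mem_filter, Finset.mem_univ, true_and] at hs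
      rw [Finset.mem_Iio]
      exact (I.1.orderEmbOfFin I.2).lt_iff_lt.1 (hs.trans_lt hlt)
    have h3 : Finset.Iic r ⊆ (Finset.univ.filter fun s : Fin k =>
        J.1.orderEmbOfFin J.2 s ≤ J.1.orderEmbOfFin J.2 r) := by
      intro s hs
      simpa using hs
    have h4 := (Finset.card_le_card h3).trans (h1.trans (Finset.card_le_card h2))
    simp at h4

namespace PartialPairing

variable {k n : ℕ}

lemma isStandard_theta (p : PartialPairing k n) : IsStandard p.firstColumn p.secondColumn := by
  refine isStandard_iff.2 fun x => p.compatible_theta.symm.card_filter_le _ fun u v huv hu hux => ?_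
  rcases mem_secondColumn.1 hu with hu | ⟨w, hw⟩
  · exact (huv.not_mem_marked hu).elim
  · have : v = w := huv.unique (Or.inr hw)
    subst this
    exact (p.strand_lt _ hw).le.trans hux

/-- Pairings with the same columns have the same strands. If the strands at `x` ended at `y < y'`,
then the strand of the second pairing ending at `y` would start at an `x'` between `x` and `y`, where
the two pairings disagree again, with an end smaller than `y`: infinite descent. -/
lemma snd_eq_of_theta_eq {p q : PartialPairing k n} (h : p.theta = q.theta) {x y y' : Fin n}
    (hp : (x, y) ∈ p.strands) (hq : (x, y') ∈ q.strands) : y = y' := by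
  have h1 : p.firstColumn = q.firstColumn := congrArg Prod.fst h
  have h2 : p.secondColumn = q.secondColumn := congrArg Prod.snd h
  have hm : p.marked = q.marked := by
    rw [← p.compatible_theta.1, ← q.compatible_theta.1, h1, h2]
  induction hN : min y.val y'.val using Nat.strong_induction_on generalizing p q x y y' with
  | _ N ih =>
    wlog hlt : y < y' generalizing p q x y y'
    · rcases lt_or_eq_of_le (not_lt.1 hlt) with hlt' | heq
      · exact (this h.symm hq hp h1.symm h2.symm hm.symm (by omega) hlt').symm
      · exact heq.symm
    exfalso
    have hy : y ∈ q.secondColumn.1 := h2 ▸ mem_secondColumn.2 (Or.inr ⟨x, hp⟩)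
    obtain ⟨x', hx'⟩ : ∃ x', (x', y) ∈ q.strands := by
      rcases mem_secondColumn.1 hy with hy | hy
      · exact ((p.unmarked _ hp).2 (hm ▸ hy)).elim
      · exact hy
    have hxy := p.strand_lt _ hp
    have hxy' := q.strand_lt _ hx'
    simp only at hxy hxy'
    have hxx' : x < x' := by
      rcases lt_trichotomy x x' with h3 | h3 | h3
      · exact h3
      · subst h3
        exact absurd (Joined.unique (p := q) (Or.inl hq) (Or.inl hx')) hlt.ne'
      · exact (q.noncrossing _ hx' _ hq ⟨h3, hxy, hlt⟩).elim
    have hx1 : x' ∈ p.firstColumn.1 := h1.symm ▸ mem_firstColumn.2 (Or.inr ⟨y, hx'⟩)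
    obtain ⟨z, hz⟩ : ∃ z, (x', z) ∈ p.strands := by
      rcases mem_firstColumn.1 hx1 with hy | hy
      · exact ((q.unmarked _ hx').1 (hm ▸ hy)).elim
      · exact hy
    have hzy : z < y := by
      rcases lt_trichotomy z y with h3 | h3 | h3
      · exact h3
      · subst h3
        exact absurd (Joined.unique (p := p) (Or.inr hp) (Or.inr hz)) hxx'.ne
      · exact (p.noncrossing _ hp _ hz ⟨hxx', hxy', h3⟩).elim
    have := ih (min z.val y.val) (by omega) h hz hx' h1 h2 hm rfl
    exact hzy.ne this

lemma theta_injective : Function.Injective (theta : PartialPairing k n → _) := by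
  have key : ∀ p q : PartialPairing k n, p.theta = q.theta → p.strands ⊆ q.strands := by
    rintro p q h ⟨x, y⟩ hs
    have h1 : p.firstColumn = q.firstColumn := congrArg Prod.fst h
    have h2 : p.secondColumn = q.secondColumn := congrArg Prod.snd h
    have hm : p.marked = q.marked := by
      rw [← p.compatible_theta.1, ← q.compatible_theta.1, h1, h2]
    have hx : x ∈ q.firstColumn.1 := h1 ▸ mem_firstColumn.2 (Or.inr ⟨y, hs⟩)
    rcases mem_firstColumn.1 hx with hx | ⟨y', hx⟩
    · exact ((p.unmarked _ hs).1 (hm ▸ hx)).elim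
    · rwa [snd_eq_of_theta_eq h hs hx]
  intro p q h
  refine PartialPairing.ext ((key p q h).antisymm (key q p h.symm)) ?_
  have h1 : p.firstColumn = q.firstColumn := congrArg Prod.fst h
  have h2 : p.secondColumn = q.secondColumn := congrArg Prod.snd h
  rw [← p.compatible_theta.1, ← q.compatible_theta.1, h1, h2]

/-- The pairing of a standard pair: the first element `y` of `J \ I` is joined to the last element
`x` of `I \ J` before it, and the rest is paired by induction, with `x` marked. -/
lemma exists_theta_eq {I J : KSubset k n} (h : IsStandard I J) :
    ∃ p : PartialPairing k n, p.theta = (I, J) := by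
  rw [isStandard_iff] at h
  induction hN : (J.1 \ I.1).card generalizing J with
  | zero =>
    have hJI : J.1 = I.1 := Finset.eq_of_subset_of_card_le
      (Finset.sdiff_eq_empty_iff_subset.1 (Finset.card_eq_zero.1 hN)) (by rw [I.2, J.2])
    refine ⟨⟨∅, I.1, by simp, by simp, by simp, by simp, by simp [I.2]⟩, ?_⟩
    refine Prod.ext (Subtype.ext ?_) (Subtype.ext ?_)
    · simp [theta, firstColumn]
    · simp [theta, secondColumn, hJI]
  | succ N ih =>
    have hne : (J.1 \ I.1).Nonempty := Finset.card_pos.1 (by omega)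
    obtain ⟨hy, hymin⟩ : (J.1 \ I.1).min' hne ∈ J.1 \ I.1 ∧
      ∀ z ∈ J.1 \ I.1, (J.1 \ I.1).min' hne ≤ z :=
      ⟨Finset.min'_mem _ _, fun z hz => Finset.min'_le _ _ hz⟩
    generalize (J.1 \ I.1).min' hne = y at hy hymin
    obtain ⟨hyJ, hyI⟩ := Finset.mem_sdiff.1 hy
    have hne' : ((I.1 \ J.1).filter (· < y)).Nonempty := by
      by_contra hemp
      rw [Finset.not_nonempty_iff_eq_empty, Finset.filter_eq_empty_iff] at hemp
      have hsub : I.1.filter (· ≤ y) ⊆ (J.1.filter (· ≤ y)).erase y := by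
        intro z hz
        obtain ⟨hzI, hzy⟩ := Finset.mem_filter.1 hz
        have hzne : z ≠ y := fun h => hyI (h ▸ hzI)
        refine Finset.mem_erase.2 ⟨hzne, Finset.mem_filter.2 ⟨?_, hzy⟩⟩
        by_contra hzJ
        exact hemp (Finset.mem_sdiff.2 ⟨hzI, hzJ⟩) (lt_of_le_of_ne hzy hzne)
      have h1 := Finset.card_le_card hsub
      rw [Finset.card_erase_of_mem (s := J.1.filter (· ≤ y)) (by simp [hyJ])] at h1
      have h2 : 0 < (J.1.filter (· ≤ y)).card :=
        Finset.card_pos.2 ⟨y, Finset.mem_filter.2 ⟨hyJ, le_rfl⟩⟩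
      have := h y
      omega
    obtain ⟨hx, hxmax⟩ : ((I.1 \ J.1).filter (· < y)).max' hne' ∈ (I.1 \ J.1).filter (· < y) ∧
      ∀ z ∈ (I.1 \ J.1).filter (· < y), z ≤ ((I.1 \ J.1).filter (· < y)).max' hne' :=
      ⟨Finset.max'_mem _ _, fun z hz => Finset.le_max' _ _ hz⟩
    generalize ((I.1 \ J.1).filter (· < y)).max' hne' = x at hx hxmax
    obtain ⟨hx, hxy⟩ := Finset.mem_filter.1 hx
    obtain ⟨hxI, hxJ⟩ := Finset.mem_sdiff.1 hx
    have hcard : (insert x (J.1.erase y)).card = k := by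
      have : 0 < J.1.card := Finset.card_pos.2 ⟨y, hyJ⟩
      rw [Finset.card_insert_of_notMem (by simp [hxJ]), Finset.card_erase_of_mem hyJ, J.2]
      rw [J.2] at this
      omega
    obtain ⟨p, hp⟩ := ih (J := ⟨insert x (J.1.erase y), hcard⟩) (by
      intro z
      by_cases hzy : z < y
      · refine Finset.card_le_card fun w hw => ?_
        obtain ⟨hw, hwz⟩ := Finset.mem_filter.1 hw
        refine Finset.mem_filter.2 ⟨?_, hwz⟩
        rcases Finset.mem_insert.1 hw with rfl | hw
        · exact hxI
        · by_contra hwI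
          have := hymin w (Finset.mem_sdiff.2 ⟨Finset.mem_of_mem_erase hw, hwI⟩)
          exact absurd (hwz.trans_lt hzy) (not_lt.2 this)
      · refine le_trans (le_of_eq ?_) (h z)
        have hyz := not_lt.1 hzy
        rw [Finset.filter_insert, if_pos (hxy.le.trans hyz), Finset.filter_erase,
          Finset.card_insert_of_notMem (by simp [hxJ]),
          Finset.card_erase_of_mem (Finset.mem_filter.2 ⟨hyJ, hyz⟩)]
        have : 0 < (J.1.filter (· ≤ z)).card :=
          Finset.card_pos.2 ⟨y, Finset.mem_filter.2 ⟨hyJ, hyz⟩⟩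
        omega) (by
      have : insert x (J.1.erase y) \ I.1 = (J.1 \ I.1).erase y := by
        ext w
        simp only [Finset.mem_sdiff, Finset.mem_insert, Finset.mem_erase]
        constructor
        · rintro ⟨rfl | h1, h2⟩
          · exact absurd hxI h2
          · exact ⟨h1.1, h1.2, h2⟩
        · rintro ⟨h1, h2, h3⟩
          exact ⟨Or.inr ⟨h1, h2⟩, h3⟩
      rw [this, Finset.card_erase_of_mem hy]
      omega)
    have hp1 : p.firstColumn = I := congrArg Prod.fst hp
    have hp2 : p.secondColumn.1 = insert x (J.1.erase y) :=
      congrArg (fun A : KSubset k n × KSubset k n => A.2.1) hp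
    have hpm : p.marked = I.1 ∩ insert x (J.1.erase y) := by
      rw [← p.compatible_theta.1, hp1, hp2]
    have hxm : x ∈ p.marked := by simp [hpm, hxI]
    have hym : y ∉ p.marked := by simp [hpm, hyI]
    -- No strand of `p` ends at `y`, or strictly between `x` and `y`.
    have hfst : ∀ s ∈ p.strands, s.1 ≠ x ∧ s.1 ≠ y ∧ ¬ (x < s.1 ∧ s.1 < y) := by
      intro s hs
      have hsI : s.1 ∈ I.1 := by
        rw [← hp1]; exact mem_firstColumn.2 (Or.inr ⟨s.2, hs⟩)
      have hsx : s.1 ≠ x := fun h => (p.unmarked s hs).1 (h ▸ hxm)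
      refine ⟨hsx, fun h => hyI (h ▸ hsI), fun hb => ?_⟩
      have hsJ : s.1 ∉ J.1 := fun hsJ => (p.unmarked s hs).1 (by
        rw [hpm]; simp [hsI, hsJ, hb.2.ne])
      exact absurd (hxmax s.1 (by simp [hsI, hsJ, hb.2])) (not_le.2 hb.1)
    have hsnd : ∀ s ∈ p.strands, s.2 ≠ x ∧ s.2 ≠ y ∧ ¬ (x < s.2 ∧ s.2 < y) := by
      intro s hs
      have hsx : s.2 ≠ x := fun h => (p.unmarked s hs).2 (h ▸ hxm)
      have hsJ' : s.2 ∈ insert x (J.1.erase y) := by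
        rw [← hp2]; exact mem_secondColumn.2 (Or.inr ⟨s.1, hs⟩)
      have hsJ : s.2 ≠ y ∧ s.2 ∈ J.1 := by
        simpa [hsx] using hsJ'
      refine ⟨hsx, hsJ.1, fun hb => ?_⟩
      have hsI : s.2 ∉ I.1 := fun hsI => (p.unmarked s hs).2 (by
        rw [hpm]; simp [hsI, hsJ])
      exact absurd (hymin s.2 (by simp [hsI, hsJ.2])) (not_le.2 hb.2)
    have hnew : (x, y) ∉ p.strands := fun hs => (hfst _ hs).1 rfl
    refine ⟨⟨insert (x, y) p.strands, p.marked.erase x, ?_, ?_, ?_, ?_, ?_⟩, ?_⟩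
    · intro s hs
      rcases Finset.mem_insert.1 hs with rfl | hs
      · exact hxy
      · exact p.strand_lt s hs
    · intro s hs t ht hst
      rcases Finset.mem_insert.1 hs with rfl | hs <;> rcases Finset.mem_insert.1 ht with rfl | ht
      · exact absurd rfl hst
      · exact ⟨(hfst t ht).1.symm, (hsnd t ht).1.symm, (hfst t ht).2.1.symm, (hsnd t ht).2.1.symm⟩
      · exact ⟨(hfst s hs).1, (hfst s hs).2.1, (hsnd s hs).1, (hsnd s hs).2.1⟩
      · exact p.strands_disjoint s hs t ht hst
    · intro s hs t ht
      rcases Finset.mem_insert.1 hs with rfl | hs <;> rcases Finset.mem_insert.1 ht with rfl | ht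
      · exact fun h => absurd h.1 (lt_irrefl _)
      · exact fun h => (hfst t ht).2.2 ⟨h.1, h.2.1⟩
      · exact fun h => (hsnd s hs).2.2 ⟨h.2.1, h.2.2⟩
      · exact p.noncrossing s hs t ht
    · intro s hs
      rcases Finset.mem_insert.1 hs with rfl | hs
      · exact ⟨by simp, fun h => hym (Finset.mem_of_mem_erase h)⟩
      · exact ⟨fun h => (p.unmarked s hs).1 (Finset.mem_of_mem_erase h),
          fun h => (p.unmarked s hs).2 (Finset.mem_of_mem_erase h)⟩
    · rw [Finset.card_erase_of_mem hxm, Finset.card_insert_of_notMem hnew]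
      have h1 := p.card_eq
      have h2 : 0 < p.marked.card := Finset.card_pos.2 ⟨x, hxm⟩
      omega
    · refine Prod.ext (Subtype.ext ?_) (Subtype.ext ?_)
      · show (firstColumn _).1 = I.1
        ext w
        rw [mem_firstColumn, ← hp1, mem_firstColumn]
        simp only [Finset.mem_erase, Finset.mem_insert, Prod.mk.injEq]
        constructor
        · rintro (h1 | ⟨z, ⟨rfl, rfl⟩ | h1⟩)
          · exact Or.inl h1.2
          · exact Or.inl hxm
          · exact Or.inr ⟨z, h1⟩
        · rintro (h1 | ⟨z, h1⟩)
          · by_cases hwx : w = x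
            · exact Or.inr ⟨y, Or.inl ⟨hwx, rfl⟩⟩
            · exact Or.inl ⟨hwx, h1⟩
          · exact Or.inr ⟨z, Or.inr h1⟩
      · show (secondColumn _).1 = J.1
        have hJ : J.1 = insert y (p.secondColumn.1.erase x) := by
          rw [hp2, Finset.erase_insert (by simp [hxJ]), Finset.insert_erase hyJ]
        ext w
        have hw : w ∈ J.1 ↔ w = y ∨ w ≠ x ∧ (w ∈ p.marked ∨ ∃ z, (z, w) ∈ p.strands) := by
          rw [hJ, Finset.mem_insert, Finset.mem_erase, mem_secondColumn]
        rw [mem_secondColumn, hw]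
        simp only [Finset.mem_erase, Finset.mem_insert, Prod.mk.injEq]
        constructor
        · rintro (h1 | ⟨z, ⟨rfl, rfl⟩ | h1⟩)
          · exact Or.inr ⟨h1.1, Or.inl h1.2⟩
          · exact Or.inl rfl
          · exact Or.inr ⟨(hsnd _ h1).1, Or.inr ⟨z, h1⟩⟩
        · rintro (rfl | ⟨h0, h1 | ⟨z, h1⟩⟩)
          · exact Or.inr ⟨x, Or.inl ⟨rfl, rfl⟩⟩
          · exact Or.inl ⟨h0, h1⟩
          · exact Or.inr ⟨z, Or.inr h1⟩

end PartialPairing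

/-! ### Swapping the ends of a strand -/

namespace PartialPairing

variable {k n : ℕ}

/-- If a strand is not nested in another one, no standard pair can have the smaller end of the
strand in its second set: before that end, the two sets have the same number of elements. -/
lemma Compatible.not_isStandard_of_outer {p : PartialPairing k n} {I J : KSubset k n}
    (h : p.Compatible I J) {x y : Fin n} (hs : (x, y) ∈ p.strands)
    (hout : ∀ e f, (e, f) ∈ p.strands → ¬ (e < x ∧ y < f)) (hx : x ∈ J.1) :
    ¬ IsStandard I J := by
  rw [isStandard_iff]
  intro hst
  have hxy : x < y := p.strand_lt _ hs
  have hxI : x ∉ I.1 := fun hI => h.not_mem_both (Or.inl hs) hI hx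
  have h1 : (I.1.filter (· < x)).card = (J.1.filter (· < x)).card := by
    refine h.card_filter_eq _ fun u v huv hux => ?_
    by_contra hvx
    rcases lt_or_eq_of_le (not_lt.1 hvx) with hvx | rfl
    · have huv' : (u, v) ∈ p.strands := by
        rcases huv with huv | huv
        · exact huv
        · exact absurd (p.strand_lt _ huv) (not_lt.2 (hux.trans hvx).le)
      rcases lt_trichotomy v y with hvy | rfl | hvy
      · exact p.noncrossing _ huv' _ hs ⟨hux, hvx, hvy⟩
      · exact hux.ne (huv.symm.unique (Or.inr hs))
      · exact hout u v huv' ⟨hux, hvy⟩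
    · have : u = y := huv.symm.unique (Or.inl hs)
      exact absurd (hux.trans hxy) (this ▸ lt_irrefl _)
  have h2 : J.1.filter (· ≤ x) = insert x (J.1.filter (· < x)) := by
    ext w
    simp only [Finset.mem_filter, Finset.mem_insert, le_iff_lt_or_eq]
    constructor
    · rintro ⟨hw, hwx | hwx⟩
      · exact Or.inr ⟨hw, hwx⟩
      · exact Or.inl hwx
    · rintro (rfl | hw)
      · exact ⟨hx, Or.inr rfl⟩
      · exact ⟨hw.1, Or.inl hw.2⟩
  have h3 : I.1.filter (· ≤ x) = I.1.filter (· < x) := by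
    refine Finset.filter_congr fun w hw => ?_
    have : w ≠ x := fun h => hxI (h ▸ hw)
    exact ⟨fun h => lt_of_le_of_ne h this, le_of_lt⟩
  have h4 := hst x
  rw [h2, h3, Finset.card_insert_of_notMem (by simp)] at h4
  omega

lemma exists_parent (p : PartialPairing k n) {x y : Fin n}
    (h : ∃ e f, (e, f) ∈ p.strands ∧ e < x ∧ y < f) :
    ∃ e f, (e, f) ∈ p.strands ∧ e < x ∧ y < f ∧
      ∀ u v, (u, v) ∈ p.strands → u < x → y < v → u ≤ e := by
  obtain ⟨e, f, h1, h2, h3⟩ := h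
  have hne : (p.strands.filter fun s => s.1 < x ∧ y < s.2).Nonempty :=
    ⟨(e, f), Finset.mem_filter.2 ⟨h1, h2, h3⟩⟩
  obtain ⟨s, hs, hmax⟩ := Finset.exists_max_image _ Prod.fst hne
  obtain ⟨hs, hs1, hs2⟩ := Finset.mem_filter.1 hs
  exact ⟨s.1, s.2, hs, hs1, hs2, fun u v huv hu hv =>
    hmax (u, v) (Finset.mem_filter.2 ⟨huv, hu, hv⟩)⟩

/-- `q` arises from `p` by replacing a strand `(x, y)` and the strand `(e, f)` around it by
`(e, x)` and `(y, f)`. On columns this swaps `x` and `y`. -/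
structure IsSwap (p q : PartialPairing k n) (x y e f : Fin n) : Prop where
  inner : (x, y) ∈ p.strands
  outer : (e, f) ∈ p.strands
  lt_inner : e < x
  lt_outer : y < f
  marked_eq : q.marked = p.marked
  mem_strands : ∀ s, s ∈ q.strands ↔
    s = (e, x) ∨ s = (y, f) ∨ (s ∈ p.strands ∧ s ≠ (x, y) ∧ s ≠ (e, f))

lemma exists_isSwap (p : PartialPairing k n) {x y e f : Fin n} (hxy : (x, y) ∈ p.strands)
    (hef : (e, f) ∈ p.strands) (hex : e < x) (hyf : y < f)
    (hmax : ∀ u v, (u, v) ∈ p.strands → u < x → y < v → u ≤ e) :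
    ∃ q : PartialPairing k n, p.IsSwap q x y e f := by
  have hlt : x < y := p.strand_lt _ hxy
  have hne : (x, y) ≠ (e, f) := fun h => hex.ne' (congrArg Prod.fst h)
  have hne1 : (e, x) ≠ (y, f) := fun h => (hex.trans hlt).ne (congrArg Prod.fst h)
  have hdis : ∀ u v, (u, v) ∈ p.strands → (u, v) ≠ (x, y) → (u, v) ≠ (e, f) →
      (u ≠ x ∧ u ≠ y ∧ v ≠ x ∧ v ≠ y) ∧ (u ≠ e ∧ u ≠ f ∧ v ≠ e ∧ v ≠ f) := fun u v h h1 h2 =>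
    ⟨p.strands_disjoint _ h _ hxy h1, p.strands_disjoint _ h _ hef h2⟩
  have hmem : ∀ s, s ∈ insert (e, x) (insert (y, f) ((p.strands.erase (x, y)).erase (e, f))) ↔
      s = (e, x) ∨ s = (y, f) ∨ (s ∈ p.strands ∧ s ≠ (x, y) ∧ s ≠ (e, f)) := by
    intro s
    simp only [Finset.mem_insert, Finset.mem_erase]
    tauto
  refine ⟨⟨insert (e, x) (insert (y, f) ((p.strands.erase (x, y)).erase (e, f))), p.marked,
    ?_, ?_, ?_, ?_, ?_⟩, hxy, hef, hex, hyf, rfl, hmem⟩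
  · intro s hs
    rcases (hmem s).1 hs with rfl | rfl | hs
    · exact hex
    · exact hyf
    · exact p.strand_lt s hs.1
  · rintro ⟨u, v⟩ hs ⟨u', v'⟩ ht hst
    rcases (hmem _).1 hs with hs | hs | ⟨hs, hs1, hs2⟩ <;>
    rcases (hmem _).1 ht with ht | ht | ⟨ht, ht1, ht2⟩
    · exact absurd (hs.trans ht.symm) hst
    · simp only [Prod.mk.injEq] at hs ht ⊢
      omega
    · have := hdis _ _ ht ht1 ht2
      simp only [Prod.mk.injEq] at hs ⊢
      omega
    · simp only [Prod.mk.injEq] at hs ht ⊢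
      omega
    · exact absurd (hs.trans ht.symm) hst
    · have := hdis _ _ ht ht1 ht2
      simp only [Prod.mk.injEq] at hs ⊢
      omega
    · have := hdis _ _ hs hs1 hs2
      simp only [Prod.mk.injEq] at ht ⊢
      omega
    · have := hdis _ _ hs hs1 hs2
      simp only [Prod.mk.injEq] at ht ⊢
      omega
    · exact p.strands_disjoint _ hs _ ht hst
  · rintro ⟨u, v⟩ hs ⟨u', v'⟩ ht hst
    rcases (hmem _).1 hs with hs | hs | ⟨hs, hs1, hs2⟩ <;>
    rcases (hmem _).1 ht with ht | ht | ⟨ht, ht1, ht2⟩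
    · simp only [Prod.mk.injEq] at hs ht hst
      omega
    · simp only [Prod.mk.injEq] at hs ht hst
      omega
    · have h1 := hdis _ _ ht ht1 ht2
      have h2 := hmax _ _ ht
      have h3 := p.noncrossing _ ht _ hxy
      simp only [Prod.mk.injEq] at hs hst h3
      omega
    · simp only [Prod.mk.injEq] at hs ht hst
      omega
    · simp only [Prod.mk.injEq] at hs ht hst
      omega
    · have h3 := p.noncrossing _ hef _ ht
      simp only [Prod.mk.injEq] at hs hst h3
      omega
    · have h3 := p.noncrossing _ hs _ hef
      simp only [Prod.mk.injEq] at ht hst h3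
      omega
    · have h1 := hdis _ _ hs hs1 hs2
      have h2 := hmax _ _ hs
      have h3 := p.noncrossing _ hs _ hef
      have h4 := p.noncrossing _ hxy _ hs
      simp only [Prod.mk.injEq] at ht hst h3 h4
      omega
    · exact p.noncrossing _ hs _ ht hst
  · intro s hs
    rcases (hmem s).1 hs with rfl | rfl | hs
    · exact ⟨(p.unmarked _ hef).1, (p.unmarked _ hxy).1⟩
    · exact ⟨(p.unmarked _ hxy).2, (p.unmarked _ hef).2⟩
    · exact p.unmarked s hs.1
  · have hyf' : (y, f) ∉ (p.strands.erase (x, y)).erase (e, f) := fun h =>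
      p.fst_ne_snd (Finset.mem_of_mem_erase (Finset.mem_of_mem_erase h)) hxy
    have hex' : (e, x) ∉ insert (y, f) ((p.strands.erase (x, y)).erase (e, f)) := by
      intro h
      rcases Finset.mem_insert.1 h with h | h
      · exact hne1 h
      · exact p.fst_ne_snd hxy (Finset.mem_of_mem_erase (Finset.mem_of_mem_erase h))
    have h1 : 0 < (p.strands.erase (x, y)).card :=
      Finset.card_pos.2 ⟨(e, f), Finset.mem_erase.2 ⟨hne.symm, hef⟩⟩
    rw [Finset.card_insert_of_notMem hex', Finset.card_insert_of_notMem hyf',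
      Finset.card_erase_of_mem (Finset.mem_erase.2 ⟨hne.symm, hef⟩)]
    rw [Finset.card_erase_of_mem hxy] at h1 ⊢
    have := p.card_eq
    omega

namespace IsSwap

variable {p q : PartialPairing k n} {x y e f : Fin n}

lemma firstColumn_eq (h : p.IsSwap q x y e f) :
    q.firstColumn.1 = insert y (p.firstColumn.1.erase x) := by
  ext w
  rw [Finset.mem_insert, Finset.mem_erase, mem_firstColumn, mem_firstColumn, h.marked_eq]
  simp only [h.mem_strands]
  constructor
  · rintro (hw | ⟨z, hz | hz | ⟨hz, hz1, -⟩⟩)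
    · exact Or.inr ⟨fun heq => (p.unmarked _ h.inner).1 (heq ▸ hw), Or.inl hw⟩
    · obtain ⟨rfl, rfl⟩ := Prod.mk.inj hz
      exact Or.inr ⟨h.lt_inner.ne, Or.inr ⟨f, h.outer⟩⟩
    · exact Or.inl (congrArg Prod.fst hz)
    · refine Or.inr ⟨?_, Or.inr ⟨z, hz⟩⟩
      rintro rfl
      exact (p.strands_disjoint _ hz _ h.inner hz1).1 rfl
  · rintro (rfl | ⟨hwx, hw | ⟨z, hz⟩⟩)
    · exact Or.inr ⟨f, Or.inr (Or.inl rfl)⟩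
    · exact Or.inl hw
    · by_cases hz2 : (w, z) = (e, f)
      · exact Or.inr ⟨x, Or.inl (by rw [(Prod.mk.inj hz2).1])⟩
      · exact Or.inr ⟨z, Or.inr (Or.inr ⟨hz, fun heq => hwx (congrArg Prod.fst heq), hz2⟩)⟩

lemma secondColumn_eq (h : p.IsSwap q x y e f) :
    q.secondColumn.1 = insert x (p.secondColumn.1.erase y) := by
  ext w
  rw [Finset.mem_insert, Finset.mem_erase, mem_secondColumn, mem_secondColumn, h.marked_eq]
  simp only [h.mem_strands]
  constructor
  · rintro (hw | ⟨z, hz | hz | ⟨hz, hz1, -⟩⟩)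
    · exact Or.inr ⟨fun heq => (p.unmarked _ h.inner).2 (heq ▸ hw), Or.inl hw⟩
    · exact Or.inl (congrArg Prod.snd hz)
    · obtain ⟨rfl, rfl⟩ := Prod.mk.inj hz
      exact Or.inr ⟨h.lt_outer.ne', Or.inr ⟨e, h.outer⟩⟩
    · refine Or.inr ⟨?_, Or.inr ⟨z, hz⟩⟩
      rintro rfl
      exact (p.strands_disjoint _ hz _ h.inner hz1).2.2.2 rfl
  · rintro (rfl | ⟨hwy, hw | ⟨z, hz⟩⟩)
    · exact Or.inr ⟨e, Or.inl rfl⟩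
    · exact Or.inl hw
    · by_cases hz2 : (z, w) = (e, f)
      · exact Or.inr ⟨y, Or.inr (Or.inl (by rw [(Prod.mk.inj hz2).2]))⟩
      · exact Or.inr ⟨z, Or.inr (Or.inr ⟨hz, fun heq => hwy (congrArg Prod.snd heq), hz2⟩)⟩

/-- If the opening `e` stays in the first set `I`, then the pairs compatible with `p` in which the
strand `(x, y)` is reversed are the pairs compatible with `q` in which `(y, f)` is not. -/
lemma compatible_iff (h : p.IsSwap q x y e f) {I J : KSubset k n} (he : e ∈ I.1) :
    q.Compatible I J ∧ y ∈ I.1 ↔ p.Compatible I J ∧ x ∉ I.1 := by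
  constructor
  · rintro ⟨hq, hy⟩
    have hex : (e, x) ∈ q.strands := (h.mem_strands _).2 (Or.inl rfl)
    have hyf : (y, f) ∈ q.strands := (h.mem_strands _).2 (Or.inr (Or.inl rfl))
    have hx : x ∈ J.1 := by
      rcases hq.2 _ hex with h1 | h1
      · exact h1.2
      · exact (hq.not_mem_both (Or.inl hex) he h1.1).elim
    have hf : f ∈ J.1 := by
      rcases hq.2 _ hyf with h1 | h1
      · exact h1.2
      · exact (hq.not_mem_both (Or.inl hyf) hy h1.1).elim
    refine ⟨⟨hq.1.trans h.marked_eq, fun s hs => ?_⟩, fun hxI =>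
      hq.not_mem_both (Or.inr hex) hxI hx⟩
    by_cases h1 : s = (x, y)
    · subst h1
      exact Or.inr ⟨hx, hy⟩
    by_cases h2 : s = (e, f)
    · subst h2
      exact Or.inl ⟨he, hf⟩
    exact hq.2 s ((h.mem_strands s).2 (Or.inr (Or.inr ⟨hs, h1, h2⟩)))
  · rintro ⟨hp, hx⟩
    have hxy : x ∈ J.1 ∧ y ∈ I.1 := by
      rcases hp.2 _ h.inner with h1 | h1
      · exact absurd h1.1 hx
      · exact h1
    have hf : f ∈ J.1 := by
      rcases hp.2 _ h.outer with h1 | h1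
      · exact h1.2
      · exact (hp.not_mem_both (Or.inl h.outer) he h1.1).elim
    refine ⟨⟨hp.1.trans h.marked_eq.symm, fun s hs => ?_⟩, hxy.2⟩
    rcases (h.mem_strands s).1 hs with rfl | rfl | hs
    · exact Or.inl ⟨he, hxy.1⟩
    · exact Or.inl ⟨hxy.2, hf⟩
    · exact hp.2 s hs.1

end IsSwap

end PartialPairing

/-! ### Steps between states -/

section

variable {k n : ℕ}

/-- The pair of sets underlying a state. -/
def PathState.toPair (z : PathState k n) : KSubset k n × KSubset k n := (seqSet z.1, z.2)

lemma mem_seqSet {f : Fin k ↪ Fin n} {x : Fin n} : x ∈ (seqSet f).1 ↔ ∃ b, f b = x := by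
  simp [seqSet]

namespace PartialPairing

lemma isStrand_iff {p : PartialPairing k n} {z : PathState k n} (h : p.theta = z.toPair)
    {x y : Fin n} : IsStrand (seqSet z.1) z.2 x y ↔ (x, y) ∈ p.strands := by
  constructor
  · rintro ⟨q, hq, hs⟩
    have : q = p := theta_injective (hq.trans h.symm)
    exact this ▸ hs
  · exact fun hs => ⟨p, h, hs⟩

/-- The index set of a state, described through `p = θ⁻¹`: the entries are the marked points and
the openings of the strands. -/
lemma mem_range_iff {p : PartialPairing k n} {z : PathState k n} (h : p.theta = z.toPair)
    {x : Fin n} : (∃ b, z.1 b = x) ↔ x ∈ p.marked ∨ ∃ y, (x, y) ∈ p.strands := by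
  have h1 : p.firstColumn = seqSet z.1 := congrArg Prod.fst h
  rw [← mem_seqSet, ← h1, mem_firstColumn]

lemma firstColumn_val {p : PartialPairing k n} {z : PathState k n} (h : p.theta = z.toPair) :
    p.firstColumn.1 = Finset.univ.map z.1 :=
  congrArg (fun A : KSubset k n × KSubset k n => A.1.1) h

lemma secondColumn_val {p : PartialPairing k n} {z : PathState k n} (h : p.theta = z.toPair) :
    p.secondColumn.1 = z.2.1 :=
  congrArg (fun A : KSubset k n × KSubset k n => A.2.1) h

/-- A strand that is not nested in another one cannot be the subject of a step. -/
lemma not_pathStep_of_outer {p : PartialPairing k n} {z z' : PathState k n}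
    (h : p.theta = z.toPair) {a : Fin k} {y : Fin n} (hs : (z.1 a, y) ∈ p.strands)
    (hout : ∀ e f, (e, f) ∈ p.strands → ¬ (e < z.1 a ∧ y < f)) : ¬ PathStep a z z' := by
  rintro ⟨j, hj, hz1, hz2, hst⟩
  rw [isStrand_iff h] at hj
  have hjy : j = y := Joined.unique (p := p) (Or.inl hj) (Or.inl hs)
  subst hjy
  have hlt : z.1 a < j := p.strand_lt _ hs
  have hcompat : p.Compatible (seqSet z.1) z.2 := by
    have h0 := p.compatible_theta
    have h1 : p.firstColumn = seqSet z.1 := congrArg Prod.fst h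
    have h2 : p.secondColumn = z.2 := congrArg Prod.snd h
    rwa [h1, h2] at h0
  have hjz : ∀ b, z.1 b ≠ j := by
    intro b hb
    rcases (mem_range_iff h).1 ⟨b, hb⟩ with h1 | ⟨w, h1⟩
    · exact (p.unmarked _ hs).2 h1
    · exact p.fst_ne_snd h1 hs
  have hmem1 : ∀ w, w ∈ (seqSet z'.1).1 ↔ w = j ∨ (w ≠ z.1 a ∧ w ∈ (seqSet z.1).1) := by
    intro w
    rw [mem_seqSet, mem_seqSet, hz1]
    constructor
    · rintro ⟨b, rfl⟩
      by_cases hb : b = a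
      · subst hb
        simp
      · rw [Function.update_of_ne hb]
        exact Or.inr ⟨fun heq => hb (z.1.injective heq), b, rfl⟩
    · rintro (rfl | ⟨hw, b, rfl⟩)
      · exact ⟨a, by simp⟩
      · exact ⟨b, Function.update_of_ne (by rintro rfl; exact hw rfl) _ _⟩
  have hmem2 : ∀ w, w ∈ z'.2.1 ↔ w = z.1 a ∨ (w ≠ j ∧ w ∈ z.2.1) := by
    intro w
    rw [hz2]
    simp
  have hcompat' : p.Compatible (seqSet z'.1) z'.2 := by
    refine ⟨?_, fun s hs' => ?_⟩
    · ext w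
      have hw : w ∈ p.marked ↔ w ∈ (seqSet z.1).1 ∧ w ∈ z.2.1 := by
        rw [← hcompat.1, Finset.mem_inter]
      rw [Finset.mem_inter, hmem1, hmem2, hw]
      have hw1 : w = z.1 a → w ∉ p.marked := fun heq => heq ▸ (p.unmarked _ hs).1
      have hw2 : w = j → w ∉ p.marked := fun heq => heq ▸ (p.unmarked _ hs).2
      rw [hw] at hw1 hw2
      have hne : w = j → w ≠ z.1 a := fun h1 h2 => hlt.ne (h2.symm.trans h1)
      tauto
    · by_cases heq : s = (z.1 a, j)
      · subst heq
        exact Or.inr ⟨(hmem2 _).2 (Or.inl rfl), (hmem1 _).2 (Or.inl rfl)⟩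
      · obtain ⟨h1, h2, h3, h4⟩ := p.strands_disjoint _ hs' _ hs heq
        exact (hcompat.2 s hs').imp
          (fun h5 => ⟨(hmem1 _).2 (Or.inr ⟨h1, h5.1⟩), (hmem2 _).2 (Or.inr ⟨h4, h5.2⟩)⟩)
          (fun h5 => ⟨(hmem2 _).2 (Or.inr ⟨h2, h5.1⟩), (hmem1 _).2 (Or.inr ⟨h3, h5.2⟩)⟩)
  exact hcompat'.not_isStandard_of_outer hs hout ((hmem2 _).2 (Or.inl rfl)) hst

/-- A nested strand can be swapped, in exactly one way, and the pairing of the new state is obtained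
by reconnecting the strand with the strand around it. -/
lemma IsSwap.existsUnique_pathStep {p q : PartialPairing k n} {z : PathState k n}
    (h : p.theta = z.toPair) {a : Fin k} {y e f : Fin n} (hq : p.IsSwap q (z.1 a) y e f) :
    ∃ z', (∀ w, PathStep a z w ↔ w = z') ∧ q.theta = z'.toPair ∧
      (z'.1 : Fin k → Fin n) = Function.update z.1 a y := by
  have hyz : ∀ b, z.1 b ≠ y := by
    intro b hb
    rcases (mem_range_iff h).1 ⟨b, hb⟩ with h1 | ⟨w, h1⟩
    · exact (p.unmarked _ hq.inner).2 h1
    · exact p.fst_ne_snd h1 hq.inner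
  have hinj : Function.Injective (Function.update z.1 a y) := by
    intro b c hbc
    by_cases hb : b = a <;> by_cases hc : c = a
    · rw [hb, hc]
    · subst hb
      rw [Function.update_self, Function.update_of_ne hc] at hbc
      exact absurd hbc.symm (hyz c)
    · subst hc
      rw [Function.update_self, Function.update_of_ne hb] at hbc
      exact absurd hbc (hyz b)
    · rw [Function.update_of_ne hb, Function.update_of_ne hc] at hbc
      exact z.1.injective hbc
  have htheta : q.theta = PathState.toPair (⟨_, hinj⟩, q.secondColumn) := by
    refine Prod.ext (Subtype.ext ?_) rfl
    show q.firstColumn.1 = Finset.univ.map ⟨Function.update z.1 a y, hinj⟩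
    rw [hq.firstColumn_eq, firstColumn_val h]
    ext w
    simp only [Finset.mem_insert, Finset.mem_erase, Finset.mem_map, Finset.mem_univ, true_and,
      Function.Embedding.coeFn_mk]
    constructor
    · rintro (rfl | ⟨hw, b, rfl⟩)
      · exact ⟨a, by simp⟩
      · exact ⟨b, Function.update_of_ne (by rintro rfl; exact hw rfl) _ _⟩
    · rintro ⟨b, rfl⟩
      by_cases hb : b = a
      · subst hb
        simp
      · rw [Function.update_of_ne hb]
        exact Or.inr ⟨fun heq => hb (z.1.injective heq), b, rfl⟩
  refine ⟨(⟨_, hinj⟩, q.secondColumn), fun w => ⟨?_, ?_⟩, htheta, rfl⟩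
  · rintro ⟨j, hj, hw1, hw2, -⟩
    rw [isStrand_iff h] at hj
    have hjy : j = y := Joined.unique (p := p) (Or.inl hj) (Or.inl hq.inner)
    subst hjy
    refine Prod.ext (DFunLike.coe_injective hw1) (Subtype.ext ?_)
    rw [hw2, ← secondColumn_val h]
    exact hq.secondColumn_eq.symm
  · rintro rfl
    refine ⟨y, (isStrand_iff h).2 hq.inner, rfl, ?_, ?_⟩
    · rw [← secondColumn_val h]
      exact hq.secondColumn_eq
    · have := q.isStandard_theta
      rwa [show q.firstColumn = _ from congrArg Prod.fst htheta] at this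

end PartialPairing

/-! ### Orientations with some strands kept -/

/-- The pair `A` is an orientation of the pairing of the state `z` in which the strands starting at
the entries with labels `< m` are not reversed. -/
def IsOrientation (A : KSubset k n × KSubset k n) (z : PathState k n) (m : ℕ) : Prop :=
  ∃ p : PartialPairing k n, p.theta = z.toPair ∧ p.Compatible A.1 A.2 ∧
    ∀ b : Fin k, b.val < m → z.1 b ∈ A.1.1

lemma isOrientation_iff {A : KSubset k n × KSubset k n} {z : PathState k n} {m : ℕ}
    {p : PartialPairing k n} (h : p.theta = z.toPair) :
    IsOrientation A z m ↔ p.Compatible A.1 A.2 ∧ ∀ b : Fin k, b.val < m → z.1 b ∈ A.1.1 := by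
  constructor
  · rintro ⟨q, hq, hs⟩
    have : q = p := PartialPairing.theta_injective (hq.trans h.symm)
    exact this ▸ hs
  · exact fun hs => ⟨p, h, hs⟩

/-- The property of the states met while the label `m - 1` is being moved: the entries with smaller
labels still have only smaller labels to their left, and the strands around the strand of `m - 1`
start at smaller labels. -/
structure Admissible (z : PathState k n) (m : ℕ) : Prop where
  lt_of_lt : ∀ b c : Fin k, b.val + 1 < m → z.1 c < z.1 b → c < b
  lt_of_nested : ∀ b c : Fin k, b.val + 1 = m → ∀ p : PartialPairing k n, p.theta = z.toPair →
    ∀ x y, (z.1 b, x) ∈ p.strands → (z.1 c, y) ∈ p.strands → z.1 c < z.1 b → x < y → c < b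

lemma Admissible.of_succ {z : PathState k n} {m : ℕ} (h : Admissible z (m + 1)) :
    Admissible z m :=
  ⟨fun _ _ hb => h.lt_of_lt _ _ (by omega), fun _ _ hb _ _ _ _ _ _ hlt _ =>
    h.lt_of_lt _ _ (by omega) hlt⟩

lemma Admissible.start (B : KSubset k n × KSubset k n) (m : ℕ) :
    Admissible (k := k) (n := n) ((B.1.1.orderEmbOfFin B.1.2).toEmbedding, B.2) m :=
  ⟨fun _ _ _ h => (B.1.1.orderEmbOfFin B.1.2).lt_iff_lt.1 h, fun _ _ _ _ _ _ _ _ _ h _ =>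
    (B.1.1.orderEmbOfFin B.1.2).lt_iff_lt.1 h⟩

open Classical in
/-- The recursion for orientations: in an orientation that keeps the labels `< a`, the strand of `a`
is either kept or reversed, and the orientations of the second kind are the orientations, keeping
the labels `≤ a`, of the state reached by a step `→_a`. -/
lemma orientation_recursion {A : KSubset k n × KSubset k n} (hA : IsStandard A.1 A.2)
    {z : PathState k n} {a : Fin k} (hz : ∃ p : PartialPairing k n, p.theta = z.toPair)
    (hadm : Admissible z (a.val + 1)) :
    (if IsOrientation A z a.val then (1 : ℤ) else 0) =
      (if IsOrientation A z (a.val + 1) then 1 else 0) +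
        ∑ w : {w // PathStep a z w}, if IsOrientation A w.1 (a.val + 1) then 1 else 0 := by
  obtain ⟨p, hp⟩ := hz
  have hsucc : ∀ Q : Fin k → Prop, (∀ b : Fin k, b.val < a.val + 1 → Q b) ↔
      (∀ b : Fin k, b.val < a.val → Q b) ∧ Q a := by
    refine fun Q => ⟨fun h => ⟨fun b hb => h b (by omega), h a (by omega)⟩, fun h b hb => ?_⟩
    rcases Nat.lt_succ_iff_lt_or_eq.1 hb with hb | hb
    · exact h.1 b hb
    · exact Fin.ext hb ▸ h.2
  -- If the strand of `a` cannot be reversed, both sides only see the orientations that keep it.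
  have hno : (∀ w, ¬ PathStep a z w) → (p.Compatible A.1 A.2 → z.1 a ∈ A.1.1) →
      (if IsOrientation A z a.val then (1 : ℤ) else 0) =
      (if IsOrientation A z (a.val + 1) then 1 else 0) +
        ∑ w : {w // PathStep a z w}, if IsOrientation A w.1 (a.val + 1) then 1 else 0 := by
    intro h1 h2
    have : IsEmpty {w // PathStep a z w} := ⟨fun w => h1 w.1 w.2⟩
    rw [Fintype.sum_empty, add_zero]
    refine if_congr ?_ rfl rfl
    rw [isOrientation_iff hp, isOrientation_iff hp, hsucc]
    tauto
  rcases (PartialPairing.mem_range_iff hp).1 ⟨a, rfl⟩ with hmark | ⟨y, hy⟩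
  · refine hno ?_ fun hc => Finset.inter_subset_left (hc.1.symm ▸ hmark)
    rintro w ⟨j, hj, -⟩
    rw [PartialPairing.isStrand_iff hp] at hj
    exact (p.unmarked _ hj).1 hmark
  by_cases hout : ∃ e f, (e, f) ∈ p.strands ∧ e < z.1 a ∧ y < f
  · obtain ⟨e, f, hef, hex, hyf, hmax⟩ := p.exists_parent hout
    obtain ⟨q, hq⟩ := p.exists_isSwap hy hef hex hyf hmax
    obtain ⟨z', hstep, hqz, hz'⟩ := hq.existsUnique_pathStep hp
    obtain ⟨c, hc⟩ := (PartialPairing.mem_range_iff hp).2 (Or.inr ⟨f, hef⟩)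
    have hca : c < a := hadm.lt_of_nested a c rfl p hp y f hy (hc ▸ hef) (hc ▸ hex) hyf
    have hsum : (∑ w : {w // PathStep a z w},
        if IsOrientation A w.1 (a.val + 1) then (1 : ℤ) else 0) =
        if IsOrientation A z' (a.val + 1) then 1 else 0 := by
      have : Subsingleton {w // PathStep a z w} :=
        ⟨fun u v => Subtype.ext (((hstep _).1 u.2).trans ((hstep _).1 v.2).symm)⟩
      rw [Fintype.sum_subsingleton _ (⟨z', (hstep z').2 rfl⟩ : {w // PathStep a z w})]
    rw [hsum]
    have hiff : IsOrientation A z' (a.val + 1) ↔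
        (∀ b : Fin k, b.val < a.val → z.1 b ∈ A.1.1) ∧ p.Compatible A.1 A.2 ∧ z.1 a ∉ A.1.1 := by
      rw [isOrientation_iff hqz, hsucc, hz', Function.update_self]
      have h1 : (∀ b : Fin k, b.val < a.val → Function.update (⇑z.1) a y b ∈ A.1.1) ↔
          ∀ b : Fin k, b.val < a.val → z.1 b ∈ A.1.1 := by
        refine forall₂_congr fun b hb => ?_
        rw [Function.update_of_ne (by rintro rfl; exact lt_irrefl _ hb)]
      rw [h1]
      constructor
      · rintro ⟨h2, h3, h4⟩
        exact ⟨h3, (hq.compatible_iff (hc ▸ h3 c hca)).1 ⟨h2, h4⟩⟩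
      · rintro ⟨h3, h2⟩
        have := (hq.compatible_iff (hc ▸ h3 c hca)).2 h2
        exact ⟨this.1, h3, this.2⟩
    have h1 := isOrientation_iff (A := A) (m := a.val) hp
    have h2 := isOrientation_iff (A := A) (m := a.val + 1) hp
    rw [hsucc] at h2
    simp only [hiff, h1, h2]
    by_cases hx : z.1 a ∈ A.1.1 <;> by_cases hC : p.Compatible A.1 A.2 <;>
      by_cases hK : ∀ b : Fin k, b.val < a.val → z.1 b ∈ A.1.1 <;>
      simp only [hx, hC, hK, true_and, and_true, and_false, false_and, not_true_eq_false,
        not_false_eq_true, if_false, add_zero, zero_add]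
  · push Not at hout
    refine hno (fun w => PartialPairing.not_pathStep_of_outer hp hy fun e f hef h =>
      absurd h.2 (not_lt.2 (hout e f hef h.1))) fun hcomp => ?_
    by_contra hx
    have hx2 : z.1 a ∈ A.2.1 := by
      rcases hcomp.2 _ hy with h | h
      · exact absurd h.1 hx
      · exact h.1
    exact hcomp.not_isStandard_of_outer hy (fun e f hef h =>
      absurd h.2 (not_lt.2 (hout e f hef h.1))) hx2 hA

/-- Admissibility is preserved while a label is being moved: the strands around the moved entry
after the step were around it before. -/
lemma Admissible.step {z z' : PathState k n} {a : Fin k}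
    (hz : ∃ p : PartialPairing k n, p.theta = z.toPair) (hadm : Admissible z (a.val + 1))
    (h : PathStep a z z') :
    (∃ q : PartialPairing k n, q.theta = z'.toPair) ∧ Admissible z' (a.val + 1) := by
  obtain ⟨p, hp⟩ := hz
  obtain ⟨y, hy, -⟩ := id h
  rw [PartialPairing.isStrand_iff hp] at hy
  by_cases hout : ∃ e f, (e, f) ∈ p.strands ∧ e < z.1 a ∧ y < f
  swap
  · push Not at hout
    exact absurd h (PartialPairing.not_pathStep_of_outer hp hy fun e f hef h =>
      absurd h.2 (not_lt.2 (hout e f hef h.1)))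
  obtain ⟨e, f, hef, hex, hyf, hmax⟩ := p.exists_parent hout
  obtain ⟨q, hq⟩ := p.exists_isSwap hy hef hex hyf hmax
  obtain ⟨w, hstep, hqw, hw⟩ := hq.existsUnique_pathStep hp
  obtain rfl := (hstep z').1 h
  have hlt : z.1 a < y := p.strand_lt _ hy
  refine ⟨⟨q, hqw⟩, fun b c hb hcb => ?_, fun b c hb r hr u v hu hv hcb huv => ?_⟩
  · have hba : b ≠ a := fun h => by subst h; omega
    rw [hw, Function.update_of_ne hba] at hcb
    by_cases hca : c = a
    · subst hca
      rw [Function.update_self] at hcb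
      exact hadm.lt_of_lt b c hb (hlt.trans hcb)
    · rw [Function.update_of_ne hca] at hcb
      exact hadm.lt_of_lt b c hb hcb
  · obtain rfl : b = a := Fin.ext (by omega)
    obtain rfl : r = q := PartialPairing.theta_injective (hr.trans hqw.symm)
    have hcb' : c ≠ b := fun h => by subst h; exact lt_irrefl _ hcb
    rw [hw, Function.update_self] at hu hcb
    rw [hw, Function.update_of_ne hcb'] at hv
    rw [Function.update_of_ne hcb'] at hcb
    -- The strand of `b` now ends at `f`; a strand around it was a strand around `(e, f)`.
    have huf : u = f := PartialPairing.Joined.unique (p := r) (Or.inl hu)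
      (Or.inl ((hq.mem_strands _).2 (Or.inr (Or.inl rfl))))
    subst huf
    have hv' : (z.1 c, v) ∈ p.strands := by
      rcases (hq.mem_strands _).1 hv with h1 | h1 | h1
      · have : v = z.1 b := congrArg Prod.snd h1
        exact absurd (this ▸ huv) (not_lt.2 (hlt.trans hq.lt_outer).le)
      · exact absurd (congrArg Prod.snd h1) huv.ne'
      · exact h1.1
    refine hadm.lt_of_nested b c rfl p hp y v hy hv' ?_ (hyf.trans huv)
    rcases lt_trichotomy (z.1 c) (z.1 b) with h1 | h1 | h1
    · exact h1
    · exact absurd (z.1.injective h1) hcb'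
    · exact (p.noncrossing _ hy _ hv' ⟨h1, hcb, hyf.trans huv⟩).elim

/-! ### Signed sums over legal paths -/

/-- A sequence of steps from the state `z` with weakly decreasing labels, all of them `< m`. Unlike
for a legal path, start and end are arbitrary; this allows induction on the first step. -/
@[ext]
structure BoundedPath (z : PathState k n) (m : ℕ) where
  length : ℕ
  state : Fin (length + 1) → PathState k n
  label : Fin length → Fin k
  start : state 0 = z
  step : ∀ i : Fin length, PathStep (label i) (state i.castSucc) (state i.succ)
  antitone : Antitone label
  label_lt : ∀ i, (label i).val < m

namespace BoundedPath

lemma length_lt {z : PathState k n} {m : ℕ} (P : BoundedPath z m) :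
    P.length < Fintype.card (PathState k n) := by
  have hmono : StrictMono fun i => ∑ r, ((P.state i).1 r : ℕ) :=
    Fin.strictMono_iff_lt_succ.2 fun i => (P.step i).sum_lt
  have hinj : Function.Injective P.state := fun i j h => hmono.injective (by simp only [h])
  simpa [Nat.succ_le_iff] using Fintype.card_le_of_injective _ hinj

instance (z : PathState k n) (m : ℕ) : Finite (BoundedPath z m) := by
  let F : BoundedPath z m → (Σ r : Fin (Fintype.card (PathState k n)),
      (Fin (r.1 + 1) → PathState k n) × (Fin r.1 → Fin k)) :=
    fun P => ⟨⟨P.length, P.length_lt⟩, P.state, P.label⟩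
  refine Finite.of_injective F ?_
  rintro ⟨r, s, l, _, _, _, _⟩ ⟨r', s', l', _, _, _, _⟩ h
  simp only [F, Sigma.mk.injEq, Fin.mk.injEq] at h
  obtain ⟨rfl, h⟩ := h
  simp only [heq_eq_eq, Prod.mk.injEq] at h
  obtain ⟨rfl, rfl⟩ := h
  rfl

noncomputable instance (z : PathState k n) (m : ℕ) : Fintype (BoundedPath z m) :=
  Fintype.ofFinite _

/-- The last state of a path. -/
def last {z : PathState k n} {m : ℕ} (P : BoundedPath z m) : PathState k n :=
  P.state (Fin.last P.length)

/-- A path without labels `≥ m`, seen as a path without labels `≥ m + 1`. -/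
def weaken {z : PathState k n} {m : ℕ} (P : BoundedPath z m) : BoundedPath z (m + 1) where
  __ := P
  label_lt i := (P.label_lt i).trans (Nat.lt_succ_self m)

/-- Put a step with the largest permitted label in front of a path. -/
def cons {z z' : PathState k n} {a : Fin k} (h : PathStep a z z')
    (P : BoundedPath z' (a.val + 1)) : BoundedPath z (a.val + 1) where
  length := P.length + 1
  state := Fin.cons z P.state
  label := Fin.cons a P.label
  start := rfl
  step i := by
    refine Fin.cases ?_ (fun i => ?_) i
    · have : (Fin.cons z P.state : Fin (P.length + 1 + 1) → PathState k n) (Fin.succ 0) = z' := by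
        rw [Fin.cons_succ, P.start]
      rw [this]
      exact h
    · rw [← Fin.succ_castSucc]
      simpa only [Fin.cons_succ] using P.step i
  antitone i j hij := by
    induction i using Fin.cases with
    | zero =>
      induction j using Fin.cases with
      | zero => exact le_rfl
      | succ j =>
        rw [Fin.cons_zero, Fin.cons_succ]
        exact Nat.lt_succ_iff.1 (P.label_lt j)
    | succ i =>
      induction j using Fin.cases with
      | zero => exact absurd hij (not_le.2 (Fin.succ_pos i))
      | succ j => simpa only [Fin.cons_succ] using P.antitone (Fin.succ_le_succ_iff.1 hij)
  label_lt i := by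
    refine Fin.cases (Nat.lt_succ_self _) (fun i => ?_) i
    rw [Fin.cons_succ]
    exact P.label_lt i

lemma last_cons {z z' : PathState k n} {a : Fin k} (h : PathStep a z z')
    (P : BoundedPath z' (a.val + 1)) : (cons h P).last = P.last := by
  show (Fin.cons z P.state : Fin (P.length + 1 + 1) → PathState k n) (Fin.last (P.length + 1)) = _
  rw [← Fin.succ_last, Fin.cons_succ]
  rfl

/-- A path with labels `≤ a` either has labels `< a` only or starts with a step `→_a`. -/
lemma bijective_split (z : PathState k n) (a : Fin k) : Function.Bijective
    (Sum.elim weaken fun P => cons P.1.2 P.2 :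
      BoundedPath z a.val ⊕ (Σ w : {w // PathStep a z w}, BoundedPath w.1 (a.val + 1)) →
        BoundedPath z (a.val + 1)) := by
  have hdisj : ∀ (P : BoundedPath z a.val) (w : PathState k n) (h : PathStep a z w)
      (Q : BoundedPath w (a.val + 1)), weaken P ≠ cons h Q := by
    intro P w h Q heq
    have h1 : ∀ i, ((weaken P).label i).val < a.val := P.label_lt
    rw [heq] at h1
    exact lt_irrefl _ (h1 (0 : Fin (Q.length + 1)))
  constructor
  · rintro (P | ⟨⟨w, hw⟩, P⟩) (Q | ⟨⟨w', hw'⟩, Q⟩) heq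
    · obtain ⟨r, s, l, _, _, _, _⟩ := P
      obtain ⟨r', s', l', _, _, _, _⟩ := Q
      simp only [Sum.elim_inl, weaken, BoundedPath.mk.injEq] at heq
      obtain ⟨rfl, h1, h2⟩ := heq
      obtain rfl := eq_of_heq h1
      obtain rfl := eq_of_heq h2
      rfl
    · exact (hdisj P w' hw' Q heq).elim
    · exact (hdisj Q w hw P heq.symm).elim
    · obtain ⟨r, s, l, hs, _, _, _⟩ := P
      obtain ⟨r', s', l', hs', _, _, _⟩ := Q
      obtain rfl : r = r' := Nat.succ.inj (congrArg length heq)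
      obtain ⟨-, h1, h2⟩ := BoundedPath.ext_iff.1 heq
      obtain rfl : s = s' := Fin.cons_right_injective (α := fun _ => PathState k n) z
        (eq_of_heq h1)
      obtain rfl : l = l' := Fin.cons_right_injective (α := fun _ => Fin k) a (eq_of_heq h2)
      obtain rfl := hs.symm.trans hs'
      rfl
  · rintro ⟨r, s, l, hs, hstep, hanti, hlt⟩
    by_cases h : ∀ i, (l i).val < a.val
    · exact ⟨Sum.inl ⟨r, s, l, hs, hstep, hanti, h⟩, rfl⟩
    · push Not at h
      obtain ⟨i, hi⟩ := h
      cases r with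
      | zero => exact i.elim0
      | succ r =>
        have h0 : l 0 = a := by
          have h1 : l i ≤ l 0 := hanti (Fin.zero_le i)
          have h2 := hlt 0
          have h3 : (l i).val ≤ (l 0).val := h1
          exact Fin.ext (by omega)
        have hw : PathStep a z (s 1) := by
          have := hstep 0
          rw [h0, Fin.castSucc_zero, hs] at this
          exact this
        refine ⟨Sum.inr ⟨⟨s 1, hw⟩, ⟨r, Fin.tail s, Fin.tail l, rfl, fun j => ?_,
          fun j j' hj => hanti (Fin.succ_le_succ_iff.2 hj), fun j => hlt _⟩⟩, ?_⟩
        · have := hstep j.succ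
          rw [← Fin.succ_castSucc] at this
          exact this
        · refine BoundedPath.ext rfl (heq_of_eq ?_) (heq_of_eq ?_)
          · show Fin.cons z (Fin.tail s) = s
            rw [← hs, Fin.cons_self_tail]
          · show Fin.cons a (Fin.tail l) = l
            rw [← h0, Fin.cons_self_tail]

open Classical in
/-- The signed sum over all paths from `z` with labels `< m` of the number of orientations of their
ends equal to `A` leaves only the orientations of `z` that keep the labels `< m`. -/
lemma sum_sign_orientation {A : KSubset k n × KSubset k n} (hA : IsStandard A.1 A.2) {m : ℕ}
    (hm : m ≤ k) (z : PathState k n) (hz : ∃ p : PartialPairing k n, p.theta = z.toPair)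
    (hadm : Admissible z m) :
    ∑ P : BoundedPath z m, (-1 : ℤ) ^ P.length * (if IsOrientation A P.last 0 then 1 else 0) =
      if IsOrientation A z m then 1 else 0 := by
  induction m generalizing z with
  | zero =>
    let P₀ : BoundedPath z 0 := ⟨0, fun _ => z, Fin.elim0, rfl, fun i => i.elim0,
      fun i => i.elim0, fun i => i.elim0⟩
    have hP : ∀ P : BoundedPath z 0, P = P₀ := by
      rintro ⟨r, s, l, hs, _, _, hlt⟩
      cases r with
      | zero =>
        refine BoundedPath.ext rfl (heq_of_eq (funext fun i => ?_))
          (heq_of_eq (funext fun i => i.elim0))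
        obtain rfl : i = (0 : Fin 1) := Subsingleton.elim (α := Fin 1) _ _
        exact hs
      | succ r => exact absurd (hlt 0) (Nat.not_lt_zero _)
    have : Subsingleton (BoundedPath z 0) := ⟨fun P Q => (hP P).trans (hP Q).symm⟩
    rw [Fintype.sum_subsingleton _ P₀]
    show (-1 : ℤ) ^ 0 * (if IsOrientation A z 0 then 1 else 0) = _
    rw [pow_zero, one_mul]
  | succ m ih =>
    obtain ⟨a, rfl⟩ : ∃ a : Fin k, a.val = m := ⟨⟨m, hm⟩, rfl⟩
    -- Moving the label `a` increases the sum of the entries, which is bounded.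
    induction hN : k * n - ∑ r, (z.1 r : ℕ) using Nat.strong_induction_on generalizing z with
    | _ N ihN =>
      have hrec := orientation_recursion hA hz hadm
      rw [← ih (by omega) z hz hadm.of_succ] at hrec
      rw [← (bijective_split z a).sum_comp, Fintype.sum_sum_type, Fintype.sum_sigma]
      have hstep : ∀ w : {w // PathStep a z w},
          ∑ P : BoundedPath w.1 (a.val + 1), (-1 : ℤ) ^ (cons w.2 P).length *
            (if IsOrientation A (cons w.2 P).last 0 then 1 else 0) =
          -(if IsOrientation A w.1 (a.val + 1) then 1 else 0) := by
        rintro ⟨w, hw⟩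
        obtain ⟨hzw, hadmw⟩ := hadm.step hz hw
        have hbound : ∑ r, (w.1 r : ℕ) ≤ k * n := by
          simpa using Finset.sum_le_card_nsmul Finset.univ (fun r => (w.1 r : ℕ)) n
            fun r _ => (w.1 r).isLt.le
        have hlt := hw.sum_lt
        rw [← ihN _ (by omega) w hzw hadmw rfl, ← Finset.sum_neg_distrib]
        refine Finset.sum_congr rfl fun P _ => ?_
        rw [last_cons]
        show (-1 : ℤ) ^ (P.length + 1) * _ = _
        ring
      refine (congrArg₂ (· + ·) rfl (Finset.sum_congr rfl fun w _ => hstep w)).trans ?_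
      show (∑ P : BoundedPath z a.val, (-1 : ℤ) ^ P.length *
        (if IsOrientation A P.last 0 then 1 else 0)) + _ = _
      rw [Finset.sum_neg_distrib, hrec]
      ring

end BoundedPath

/-- The sequence `𝐈₀` of a pair `(I, J)`, together with `J`. -/
def startState (B : KSubset k n × KSubset k n) : PathState k n :=
  ((B.1.1.orderEmbOfFin B.1.2).toEmbedding, B.2)

lemma toPair_startState (B : KSubset k n × KSubset k n) : (startState B).toPair = B := by
  refine Prod.ext (Subtype.ext ?_) rfl
  exact Finset.map_orderEmbOfFin_univ B.1.1 B.1.2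

/-- Legal paths are the bounded paths with prescribed ends. -/
def legalPathEquiv (B C : KSubset k n × KSubset k n) :
    LegalPath B C ≃ {P : BoundedPath (startState B) k // P.last.toPair = C} where
  toFun P := ⟨⟨P.length, P.state, P.label, P.start, P.step, P.antitone, fun i => (P.label i).isLt⟩,
    P.finish⟩
  invFun P := ⟨P.1.length, P.1.state, P.1.label, P.1.start, P.1.step, P.1.antitone, P.2⟩
  left_inv _ := rfl
  right_inv _ := rfl

open Classical in
/-- The matrix of signed path counts is inverse to the transposed compatibility matrix. -/
theorem sum_compatible_signedPathCount {A B : KSubset k n × KSubset k n}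
    (hA : IsStandard A.1 A.2) (hB : IsStandard B.1 B.2) :
    ∑ p : PartialPairing k n with p.Compatible A.1 A.2, signedPathCount B p.theta =
      if A = B then 1 else 0 := by
  have h1 : ∀ C, signedPathCount B C = ∑ P : BoundedPath (startState B) k,
      if P.last.toPair = C then (-1) ^ P.length else 0 := by
    intro C
    rw [signedPathCount, ← Finset.sum_filter,
      Finset.sum_subtype (Finset.univ.filter fun P : BoundedPath (startState B) k =>
        P.last.toPair = C) (p := fun P => P.last.toPair = C) (by simp)]
    exact Fintype.sum_equiv (legalPathEquiv B C) _ _ fun _ => rfl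
  simp only [h1]
  rw [Finset.sum_comm]
  have h2 : ∀ P : BoundedPath (startState B) k,
      (∑ p : PartialPairing k n with p.Compatible A.1 A.2,
        if P.last.toPair = p.theta then (-1 : ℤ) ^ P.length else 0) =
      (-1 : ℤ) ^ P.length * (if IsOrientation A P.last 0 then 1 else 0) := by
    intro P
    by_cases hP : IsOrientation A P.last 0
    · rw [if_pos hP]
      obtain ⟨p, hp, hc, -⟩ := hP
      rw [Finset.sum_eq_single_of_mem p (by simpa using hc), if_pos hp.symm, mul_one]
      intro q _ hq
      exact if_neg fun h => hq (PartialPairing.theta_injective (hp.trans h).symm)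
    · rw [if_neg hP, mul_zero]
      refine Finset.sum_eq_zero fun p hp => if_neg fun h => hP ⟨p, h.symm, ?_, ?_⟩
      · simpa using hp
      · exact fun b hb => absurd hb (Nat.not_lt_zero _)
  obtain ⟨p, hp⟩ := PartialPairing.exists_theta_eq hB
  have hp' : p.theta = (startState B).toPair := hp.trans (toPair_startState B).symm
  rw [Finset.sum_congr rfl fun P _ => h2 P, BoundedPath.sum_sign_orientation hA le_rfl _ ⟨p, hp'⟩
    (Admissible.start B k)]
  refine if_congr ?_ rfl rfl
  rw [isOrientation_iff hp']
  have hp1 : p.firstColumn = B.1 := congrArg Prod.fst hp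
  have hp2 : p.secondColumn = B.2 := congrArg Prod.snd hp
  constructor
  · rintro ⟨hc, hmem⟩
    have h1 : B.1.1 = A.1.1 := by
      refine Finset.eq_of_subset_of_card_le (fun x hx => ?_) (by rw [A.1.2, B.1.2])
      obtain ⟨b, rfl⟩ : ∃ b, (startState B).1 b = x := by
        rw [← mem_seqSet]
        rwa [show seqSet (startState B).1 = B.1 from congrArg Prod.fst (toPair_startState B)]
      exact hmem b b.isLt
    have h2 : B.2.1 = A.2.1 := by
      refine Finset.eq_of_subset_of_card_le (fun x hx => ?_) (by rw [A.2.2, B.2.2])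
      rw [← hp2, PartialPairing.mem_secondColumn] at hx
      rcases hx with hx | ⟨w, hw⟩
      · exact Finset.inter_subset_right (hc.1.symm ▸ hx)
      · rcases hc.2 _ hw with h3 | h3
        · exact h3.2
        · have h4 : w ∈ A.1.1 := by
            rw [← h1, ← hp1]
            exact PartialPairing.mem_firstColumn.2 (Or.inr ⟨x, hw⟩)
          exact (hc.not_mem_both (Or.inl hw) h4 h3.1).elim
    exact Prod.ext (Subtype.ext h1.symm) (Subtype.ext h2.symm)
  · rintro rfl
    have hc := p.compatible_theta
    rw [hp1, hp2] at hc
    exact ⟨hc, fun b _ => Finset.orderEmbOfFin_mem _ _ _⟩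

/-! ### Straightening -/

section Straightening

variable {α V : Type*} [DecidableEq α] [AddCommGroup V] [Module ℂ V] {ψ : Finset α → V} {m : ℕ}
  {S : Finset α}

/-- Double counting of the pairs `b ∈ B` with `#B = m + 1`: the vanishing of the sums over the
`m`-subsets of all `(m + 1)`-sets carries over to larger sets, in characteristic zero. -/
lemma sum_powersetCard_eq_zero
    (hψ : ∀ B ⊆ S, B.card = m + 1 → ∑ b ∈ B, ψ (B.erase b) = 0) {G : Finset α} (hG : G ⊆ S)
    (hm : m < G.card) : ∑ A ∈ G.powersetCard m, ψ A = 0 := by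
  have h1 : ∑ B ∈ G.powersetCard (m + 1), ∑ b ∈ B, ψ (B.erase b) = 0 := by
    refine Finset.sum_eq_zero fun B hB => ?_
    obtain ⟨hB, hcard⟩ := Finset.mem_powersetCard.1 hB
    exact hψ B (hB.trans hG) hcard
  have h2 : ∑ B ∈ G.powersetCard (m + 1), ∑ b ∈ B, ψ (B.erase b) =
      ∑ A ∈ G.powersetCard m, ∑ b ∈ G \ A, ψ A := by
    rw [Finset.sum_sigma', Finset.sum_sigma']
    refine Finset.sum_bij' (fun x _ => ⟨x.1.erase x.2, x.2⟩) (fun x _ => ⟨insert x.2 x.1, x.2⟩)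
      ?_ ?_ ?_ ?_ ?_
    · rintro ⟨B, b⟩ h
      simp only [Finset.mem_sigma, Finset.mem_powersetCard] at h
      obtain ⟨⟨hB, hcard⟩, hb⟩ := h
      simp only [Finset.mem_sigma, Finset.mem_powersetCard, Finset.mem_sdiff, Finset.mem_erase]
      refine ⟨⟨(Finset.erase_subset _ _).trans hB, ?_⟩, hB hb, fun h => h.1 rfl⟩
      rw [Finset.card_erase_of_mem hb, hcard, Nat.add_sub_cancel]
    · rintro ⟨A, b⟩ h
      simp only [Finset.mem_sigma, Finset.mem_powersetCard, Finset.mem_sdiff] at h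
      obtain ⟨⟨hA, hcard⟩, hb, hbA⟩ := h
      simp only [Finset.mem_sigma, Finset.mem_powersetCard]
      refine ⟨⟨Finset.insert_subset hb hA, ?_⟩, Finset.mem_insert_self _ _⟩
      rw [Finset.card_insert_of_notMem hbA, hcard]
    · rintro ⟨B, b⟩ h
      simp only [Finset.mem_sigma] at h
      simp [Finset.insert_erase h.2]
    · rintro ⟨A, b⟩ h
      simp only [Finset.mem_sigma, Finset.mem_sdiff] at h
      simp [Finset.erase_insert h.2.2]
    · exact fun _ _ => rfl
  have h3 : ∑ A ∈ G.powersetCard m, ∑ b ∈ G \ A, ψ A =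
      (G.card - m) • ∑ A ∈ G.powersetCard m, ψ A := by
    rw [Finset.smul_sum]
    refine Finset.sum_congr rfl fun A hA => ?_
    obtain ⟨hA, hcard⟩ := Finset.mem_powersetCard.1 hA
    rw [Finset.sum_const, Finset.card_sdiff_of_subset hA, hcard]
  rw [h2, h3, ← Nat.cast_smul_eq_nsmul ℂ, smul_eq_zero] at h1
  refine h1.resolve_left ?_
  rw [Nat.cast_eq_zero]
  omega

lemma sum_powersetCard_superset_eq_zero
    (hψ : ∀ B ⊆ S, B.card = m + 1 → ∑ b ∈ B, ψ (B.erase b) = 0) (X : Finset α) {G : Finset α}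
    (hX : X ⊆ S) (hG : G ⊆ S) (hXG : Disjoint X G) (hm : m < G.card) :
    ∑ A ∈ (X ∪ G).powersetCard m with X ⊆ A, ψ A = 0 := by
  induction X using Finset.induction_on generalizing G with
  | empty => simpa using sum_powersetCard_eq_zero hψ hG hm
  | insert x X hx ih =>
    rw [Finset.insert_subset_iff] at hX
    rw [Finset.disjoint_insert_left] at hXG
    -- Sets between `X` and `X ∪ G ∪ {x}` contain `x` or not.
    have h1 := ih (G := insert x G) hX.2 (Finset.insert_subset hX.1 hG)
      (Finset.disjoint_insert_right.2 ⟨hx, hXG.2⟩)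
      (by rw [Finset.card_insert_of_notMem hXG.1]; omega)
    have h2 := ih hX.2 hG hXG.2 hm
    rw [← Finset.sum_filter_add_sum_filter_not _ (fun A => x ∈ A)] at h1
    have h3 : ((Finset.powersetCard m (X ∪ insert x G)).filter (X ⊆ ·)).filter (¬ x ∈ ·) =
        (Finset.powersetCard m (X ∪ G)).filter (X ⊆ ·) := by
      ext A
      simp only [Finset.mem_filter, Finset.mem_powersetCard, Finset.union_insert]
      constructor
      · rintro ⟨⟨⟨h1, h2⟩, h3⟩, h4⟩
        exact ⟨⟨(Finset.subset_insert_iff_of_notMem h4).1 h1, h2⟩, h3⟩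
      · rintro ⟨⟨h1, h2⟩, h3⟩
        refine ⟨⟨⟨h1.trans (Finset.subset_insert _ _), h2⟩, h3⟩, fun h4 => ?_⟩
        rcases Finset.mem_union.1 (h1 h4) with h5 | h5
        · exact hx h5
        · exact hXG.1 h5
    have h4 : ((Finset.powersetCard m (X ∪ insert x G)).filter (X ⊆ ·)).filter (x ∈ ·) =
        (Finset.powersetCard m (insert x X ∪ G)).filter (insert x X ⊆ ·) := by
      ext A
      simp only [Finset.mem_filter, Finset.mem_powersetCard, Finset.union_insert,
        Finset.insert_union, Finset.insert_subset_iff]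
      tauto
    rw [h3, h2, add_zero, h4] at h1
    exact h1

end Straightening

/-- A function on the `m`-subsets `A` of a set `S` with `2m` elements whose sums over the
`m`-subsets of `(m + 1)`-sets vanish is determined by its values on the sets `A` for which
`(A, S \ A)` is standard. If the ballot condition fails at `x`, the elements of `S \ A` up to `x`
and those of `A` after `x` are together more than `m`, and redistributing them expresses the value
at `A` through sets with a smaller sum of elements. -/
lemma eq_zero_of_eq_zero_on_ballot {n m : ℕ} {V : Type*} [AddCommGroup V] [Module ℂ V]
    {ψ : Finset (Fin n) → V} {S : Finset (Fin n)}
    (hψ : ∀ B ⊆ S, B.card = m + 1 → ∑ b ∈ B, ψ (B.erase b) = 0)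
    (hst : ∀ A ⊆ S, A.card = m →
      (∀ x, ((S \ A).filter (· ≤ x)).card ≤ (A.filter (· ≤ x)).card) → ψ A = 0)
    {A : Finset (Fin n)} (hA : A ⊆ S) (hcard : A.card = m) : ψ A = 0 := by
  induction hN : ∑ a ∈ A, a.val using Nat.strong_induction_on generalizing A with
  | _ N ih =>
    by_cases hball : ∀ x, ((S \ A).filter (· ≤ x)).card ≤ (A.filter (· ≤ x)).card
    · exact hst A hA hcard hball
    push Not at hball
    obtain ⟨x, hx⟩ := hball
    set X := A.filter (· ≤ x) with hXdef
    set G := (S \ A).filter (· ≤ x) ∪ A.filter (¬ · ≤ x) with hGdef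
    have hXA : X ⊆ A := Finset.filter_subset _ _
    have hGS : G ⊆ S := Finset.union_subset
      ((Finset.filter_subset _ _).trans Finset.sdiff_subset) ((Finset.filter_subset _ _).trans hA)
    have hdisj : Disjoint X G := by
      rw [Finset.disjoint_left]
      intro a ha hb
      simp only [hXdef, hGdef, Finset.mem_union, Finset.mem_filter, Finset.mem_sdiff] at ha hb
      tauto
    have hGcard : m < G.card := by
      rw [hGdef, Finset.card_union_of_disjoint]
      · have := Finset.card_filter_add_card_filter_not (s := A) (· ≤ x)
        rw [← hXdef] at this
        omega
      · rw [Finset.disjoint_left]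
        intro a ha hb
        simp only [Finset.mem_filter, Finset.mem_sdiff] at ha hb
        tauto
    have hsum := sum_powersetCard_superset_eq_zero hψ X (hXA.trans hA) hGS hdisj hGcard
    have hmem : A ∈ ((X ∪ G).powersetCard m).filter (X ⊆ ·) := by
      refine Finset.mem_filter.2 ⟨Finset.mem_powersetCard.2 ⟨fun a ha => ?_, hcard⟩, hXA⟩
      simp only [hXdef, hGdef, Finset.mem_union, Finset.mem_filter]
      tauto
    rw [Finset.sum_eq_single_of_mem A hmem] at hsum
    · exact hsum
    intro A' hA' hne
    obtain ⟨hA', hXA'⟩ := Finset.mem_filter.1 hA'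
    obtain ⟨hA'sub, hA'card⟩ := Finset.mem_powersetCard.1 hA'
    refine ih _ ?_ (hA'sub.trans (Finset.union_subset (hXA.trans hA) hGS)) hA'card rfl
    have hlow : ∀ a ∈ A' \ A, a.val ≤ x.val := by
      intro a ha
      obtain ⟨h1, h2⟩ := Finset.mem_sdiff.1 ha
      have h3 := hA'sub h1
      simp only [hXdef, hGdef, Finset.mem_union, Finset.mem_filter, Finset.mem_sdiff] at h3
      have h4 : a ≤ x := by tauto
      exact h4
    have hhigh : ∀ a ∈ A \ A', x.val + 1 ≤ a.val := by
      intro a ha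
      obtain ⟨h1, h2⟩ := Finset.mem_sdiff.1 ha
      by_contra h3
      exact h2 (hXA' (Finset.mem_filter.2 ⟨h1, show a.val ≤ x.val by omega⟩))
    have h1 : ∑ a ∈ A' \ A, a.val ≤ _ := Finset.sum_le_card_nsmul _ _ _ hlow
    have h2 : _ ≤ ∑ a ∈ A \ A', a.val := Finset.card_nsmul_le_sum _ _ _ hhigh
    have h3 : (A' \ A).card = (A \ A').card := by
      have h4 := Finset.card_sdiff_add_card_inter A A'
      have h5 := Finset.card_sdiff_add_card_inter A' A
      rw [Finset.inter_comm] at h5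
      omega
    have h4 : 0 < (A' \ A).card := by
      rw [Finset.card_pos, Finset.sdiff_nonempty]
      exact fun h => hne (Finset.eq_of_subset_of_card_le h (by omega))
    have h5 := Finset.sum_inter_add_sum_sdiff A A' (fun a => a.val)
    have h6 := Finset.sum_inter_add_sum_sdiff A' A (fun a => a.val)
    rw [Finset.inter_comm] at h6
    rw [h3] at h1 h4
    simp only [smul_eq_mul, mul_add, mul_one] at h1 h2
    omega

/-! ### Plücker relations -/

/-- The number of elements of `F` smaller than `x`. -/
def below (F : Finset (Fin n)) (x : Fin n) : ℕ := (F.filter (· < x)).card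

lemma below_union {F G : Finset (Fin n)} (h : Disjoint F G) (x : Fin n) :
    below (F ∪ G) x = below F x + below G x := by
  rw [below, Finset.filter_union, Finset.card_union_of_disjoint
    (Finset.disjoint_filter_filter h)]
  rfl

/-- The sign of a sequence of distinct elements, as a product over pairs of positions. -/
def seqSign (f : Fin k → Fin n) : ℤ := ∏ j, ∏ i ∈ Finset.Iio j, if f i < f j then 1 else -1

lemma sign_sort_eq_seqSign {f : Fin k → Fin n} (hf : Function.Injective f) :
    ((Equiv.Perm.sign (Tuple.sort f) : ℤˣ) : ℤ) = seqSign f := by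
  have hmono : StrictMono (f ∘ Tuple.sort f) :=
    (Tuple.monotone_sort f).strictMono_of_injective (hf.comp (Tuple.sort f).injective)
  rw [← Equiv.Perm.sign_inv, Equiv.Perm.sign_eq_prod_prod_Iio, seqSign, Units.coe_prod]
  refine Finset.prod_congr rfl fun j _ => ?_
  rw [Units.coe_prod]
  refine Finset.prod_congr rfl fun i _ => ?_
  have h : (Tuple.sort f)⁻¹ i < (Tuple.sort f)⁻¹ j ↔ f i < f j := by
    rw [← hmono.lt_iff_lt]
    simp
  by_cases hij : f i < f j
  · rw [if_pos (h.2 hij), if_pos hij]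
    rfl
  · rw [if_neg (fun h' => hij (h.1 h')), if_neg hij]
    rfl

lemma seqSign_mul_self (f : Fin k → Fin n) : seqSign f * seqSign f = 1 := by
  rw [seqSign, ← Finset.prod_mul_distrib]
  refine Finset.prod_eq_one fun j _ => ?_
  rw [← Finset.prod_mul_distrib]
  refine Finset.prod_eq_one fun i _ => ?_
  split_ifs <;> rfl

/-- Changing the entry of a sequence in position `s` changes the sign by the number of other entries
which the new value has to pass. -/
lemma seqSign_update {f : Fin k → Fin n} {s : Fin k} {x : Fin n} (hf : ∀ i ≠ s, f i ≠ f s)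
    (hx : ∀ i ≠ s, f i ≠ x) :
    seqSign (Function.update f s x) * seqSign f =
      ∏ i ∈ Finset.univ.erase s, (if f i < x then -1 else 1) * (if f i < f s then -1 else 1) := by
  set d : Fin k → ℤ := fun i => (if f i < x then -1 else 1) * (if f i < f s then -1 else 1) with hd
  have key : ∀ j, ∀ i ∈ Finset.Iio j,
      (if Function.update f s x i < Function.update f s x j then (1 : ℤ) else -1) *
        (if f i < f j then 1 else -1) = (if j = s then d i else 1) * (if i = s then d j else 1) := by
    intro j i hij
    rw [Finset.mem_Iio] at hij
    by_cases hj : j = s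
    · subst hj
      rw [Function.update_self, Function.update_of_ne hij.ne, if_pos rfl, if_neg hij.ne, mul_one, hd]
      dsimp only
      split_ifs <;> rfl
    · rw [Function.update_of_ne hj, if_neg hj, one_mul]
      by_cases hi : i = s
      · subst hi
        rw [Function.update_self, if_pos rfl, hd]
        have h1 : f i < f j ↔ ¬ f j < f i :=
          ⟨fun h => h.not_gt, fun h => lt_of_le_of_ne (not_lt.1 h) (hf j hj).symm⟩
        have h2 : x < f j ↔ ¬ f j < x :=
          ⟨fun h => h.not_gt, fun h => lt_of_le_of_ne (not_lt.1 h) (hx j hj).symm⟩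
        simp only [h1, h2]
        split_ifs <;> rfl
      · rw [Function.update_of_ne hi, if_neg hi]
        split_ifs <;> rfl
  have h1 : seqSign (Function.update f s x) * seqSign f =
      ∏ j, ∏ i ∈ Finset.Iio j, (if j = s then d i else 1) * (if i = s then d j else 1) := by
    rw [seqSign, seqSign, ← Finset.prod_mul_distrib]
    refine Finset.prod_congr rfl fun j _ => ?_
    rw [← Finset.prod_mul_distrib]
    exact Finset.prod_congr rfl (key j)
  have h2 : ∏ j, ∏ i ∈ Finset.Iio j, (if j = s then d i else 1) = ∏ i ∈ Finset.Iio s, d i := by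
    rw [Finset.prod_eq_single_of_mem s (Finset.mem_univ s)]
    · simp
    · intro j _ hj
      simp [hj]
  have h3 : ∏ j, ∏ i ∈ Finset.Iio j, (if i = s then d j else 1) = ∏ j ∈ Finset.Ioi s, d j := by
    simp_rw [Finset.prod_ite_eq', Finset.mem_Iio]
    rw [← Finset.prod_filter]
    refine Finset.prod_congr ?_ fun _ _ => rfl
    ext j
    simp
  rw [h1]
  simp_rw [Finset.prod_mul_distrib]
  rw [h2, h3, ← Finset.prod_union]
  · refine Finset.prod_congr ?_ fun _ _ => rfl
    ext j
    simp [lt_or_lt_iff_ne]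
  · rw [Finset.disjoint_left]
    intro j hj hj'
    exact lt_asymm (Finset.mem_Iio.1 hj) (Finset.mem_Ioi.1 hj')

lemma seqSign_update_eq {f : Fin k → Fin n} {s : Fin k} {x : Fin n} (hf : Function.Injective f)
    {F : Finset (Fin n)} (hF : (Finset.univ.erase s).image f = F) (hx : x ∉ F) :
    seqSign (Function.update f s x) = seqSign f * (-1) ^ (below F x + below F (f s)) := by
  have h1 := seqSign_update (f := f) (s := s) (x := x) (fun i hi => hf.ne hi) (by
    intro i hi h
    exact hx (hF ▸ h ▸ Finset.mem_image_of_mem f (Finset.mem_erase.2 ⟨hi, Finset.mem_univ i⟩)))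
  have h2 : ∏ i ∈ Finset.univ.erase s,
      ((if f i < x then -1 else 1) * (if f i < f s then -1 else 1) : ℤ) =
      (-1) ^ (below F x + below F (f s)) := by
    have h3 : ∀ y : Fin n, ∏ i ∈ Finset.univ.erase s, (if f i < y then -1 else 1 : ℤ) =
        (-1) ^ below F y := by
      intro y
      rw [below, ← hF, ← Finset.prod_image (f := fun z => if z < y then (-1 : ℤ) else 1)
        (fun _ _ _ _ h => hf h), Finset.prod_ite, Finset.prod_const, Finset.prod_const_one, mul_one]
    rw [Finset.prod_mul_distrib, h3, h3, pow_add]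
  rw [h2] at h1
  calc seqSign (Function.update f s x)
      = seqSign f * (seqSign (Function.update f s x) * seqSign f) := by
        rw [mul_comm (seqSign (Function.update f s x)), ← mul_assoc, seqSign_mul_self, one_mul]
    _ = _ := by rw [h1]

/-- The Plücker coordinate of a finite set, with value `0` unless the set has `k` elements. -/
noncomputable def coordOf (k : ℕ) (I : Finset (Fin n)) : PluckerRing k n :=
  if h : I.card = k then pluckerCoord ⟨I, h⟩ else 0

lemma coordOf_val (I : KSubset k n) : coordOf k I.1 = pluckerCoord I := dif_pos I.2

lemma mk_pluckerSymbol {f : Fin k → Fin n} (hf : Function.Injective f) :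
    Ideal.Quotient.mk (pluckerIdeal k n) (pluckerSymbol f) =
      (seqSign f : PluckerRing k n) * coordOf k (Finset.univ.image f) := by
  have h : Finset.univ.image f = (seqSet ⟨f, hf⟩).1 := by
    exact (Finset.map_eq_image ⟨f, hf⟩ Finset.univ).symm
  rw [h, coordOf_val, pluckerSymbol, dif_pos hf, map_mul, sign_sort_eq_seqSign hf, map_intCast]
  rfl

lemma mk_pluckerSymbol_of_not_injective {f : Fin k → Fin n} (hf : ¬ Function.Injective f) :
    Ideal.Quotient.mk (pluckerIdeal k n) (pluckerSymbol f) = 0 := by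
  rw [pluckerSymbol, dif_neg hf, map_zero]

/-- A function of two subsets satisfies the (alternating sum form of the) Plücker relations. -/
def IsPlucker {V : Type*} [AddCommGroup V] (k : ℕ) (Φ : Finset (Fin n) → Finset (Fin n) → V) :
    Prop :=
  ∀ F H : Finset (Fin n), F.card + 1 = k → H.card = k + 1 →
    ∑ b ∈ H \ F, (-1 : ℤ) ^ (below F b + below H b) • Φ (H.erase b) (insert b F) = 0

lemma below_erase_erase {H : Finset (Fin n)} {b c : Fin n} (hb : b ∈ H) (hc : c ∈ H)
    (hbc : b ≠ c) :
    below ((H.erase b).erase c) b + below ((H.erase b).erase c) c + 1 = below H b + below H c := by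
  have key : ∀ b c : Fin n, b ∈ H → c ∈ H → b < c →
      below ((H.erase b).erase c) b + below ((H.erase b).erase c) c + 1 =
        below H b + below H c := by
    intro b c hb hc hlt
    have h1 : ((H.erase b).erase c).filter (· < b) = H.filter (· < b) := by
      ext x
      simp only [Finset.mem_filter, Finset.mem_erase]
      constructor
      · exact fun h => ⟨h.1.2.2, h.2⟩
      · exact fun h => ⟨⟨(h.2.trans hlt).ne, h.2.ne, h.1⟩, h.2⟩
    have h2 : ((H.erase b).erase c).filter (· < c) = (H.filter (· < c)).erase b := by
      ext x
      simp only [Finset.mem_filter, Finset.mem_erase]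
      constructor
      · exact fun h => ⟨h.1.2.1, h.1.2.2, h.2⟩
      · exact fun h => ⟨⟨h.2.2.ne, h.1, h.2.1⟩, h.2.2⟩
    have hmem : b ∈ H.filter (· < c) := Finset.mem_filter.2 ⟨hb, hlt⟩
    have h3 := Finset.card_pos.2 ⟨b, hmem⟩
    rw [below, below, below, below, h1, h2, Finset.card_erase_of_mem hmem]
    omega
  rcases lt_or_gt_of_ne hbc with h | h
  · exact key b c hb hc h
  · have := key c b hc hb h
    rw [Finset.erase_right_comm] at this
    omega

lemma isPlucker_coordOf :
    IsPlucker k fun I J : Finset (Fin n) => coordOf k I * coordOf k J := by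
  intro F H hF hH
  rcases (H \ F).eq_empty_or_nonempty with hemp | ⟨b₀, hb₀⟩
  · rw [hemp, Finset.sum_empty]
  obtain ⟨hb₀H, hb₀F⟩ := Finset.mem_sdiff.1 hb₀
  subst hF
  set k := F.card with hk
  have hHcard : (H.erase b₀).card = k + 1 := by
    rw [Finset.card_erase_of_mem hb₀H, hH, Nat.add_sub_cancel]
  -- The relation for the sequences `(b₀, F)` and `H \ {b₀}`, exchanging `b₀`.
  set f : Fin (k + 1) → Fin n := Fin.cons b₀ (F.orderEmbOfFin rfl) with hf
  set g : Fin (k + 1) → Fin n := ⇑((H.erase b₀).orderEmbOfFin hHcard) with hg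
  have hf0 : f 0 = b₀ := rfl
  have hcons_inj : ∀ b, b ∉ F → Function.Injective
      (Fin.cons b (F.orderEmbOfFin rfl) : Fin (k + 1) → Fin n) := by
    intro b hb
    rw [Fin.cons_injective_iff]
    refine ⟨?_, (F.orderEmbOfFin rfl).injective⟩
    rintro ⟨i, hi⟩
    exact hb (hi ▸ Finset.orderEmbOfFin_mem F rfl i)
  have hcons_image : ∀ b, Finset.univ.image
      (Fin.cons b (F.orderEmbOfFin rfl) : Fin (k + 1) → Fin n) = insert b F := by
    intro b
    ext x
    have h1 : x ∈ F ↔ ∃ i, F.orderEmbOfFin rfl i = x := by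
      have := Finset.range_orderEmbOfFin F rfl
      rw [← Finset.mem_coe, ← this, Set.mem_range]
    simp only [Finset.mem_image, Finset.mem_univ, true_and, Finset.mem_insert, Fin.exists_fin_succ,
      Fin.cons_zero, Fin.cons_succ, h1]
    exact or_congr eq_comm Iff.rfl
  have hupd : ∀ b, Function.update f 0 b = Fin.cons b (F.orderEmbOfFin rfl) := by
    intro b
    rw [hf, Fin.update_cons_zero]
  have hfinj : Function.Injective f := hcons_inj b₀ hb₀F
  have hfF : (Finset.univ.erase 0).image f = F := by
    rw [Finset.image_erase hfinj, hcons_image, hf0, Finset.erase_insert hb₀F]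
  have hginj : Function.Injective g := ((H.erase b₀).orderEmbOfFin hHcard).injective
  have hgimage : Finset.univ.image g = H.erase b₀ := by
    rw [hg]
    exact Finset.image_orderEmbOfFin_univ _ _
  have hgmem : ∀ t, g t ∈ H.erase b₀ := fun t => Finset.orderEmbOfFin_mem _ _ t
  have hgH : ∀ t, (Finset.univ.erase t).image g = (H.erase b₀).erase (g t) := by
    intro t
    rw [Finset.image_erase hginj, hgimage]
  have hgupd_image : ∀ t, Finset.univ.image (Function.update g t b₀) = H.erase (g t) := by
    intro t
    have h1 : Finset.univ.image (Function.update g t b₀) =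
        insert b₀ ((Finset.univ.erase t).image g) := by
      ext x
      simp only [Finset.mem_image, Finset.mem_univ, true_and, Finset.mem_insert, Finset.mem_erase,
        and_true]
      constructor
      · rintro ⟨i, rfl⟩
        by_cases hi : i = t
        · subst hi
          simp
        · exact Or.inr ⟨i, hi, (Function.update_of_ne hi _ _).symm⟩
      · rintro (rfl | ⟨i, hi, rfl⟩)
        · exact ⟨t, Function.update_self _ _ _⟩
        · exact ⟨i, Function.update_of_ne hi _ _⟩
    rw [h1, hgH, Finset.erase_right_comm, Finset.insert_erase]
    exact Finset.mem_erase.2 ⟨(Finset.ne_of_mem_erase (hgmem t)).symm, hb₀H⟩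
  have hgupd_inj : ∀ t, Function.Injective (Function.update g t b₀) := by
    intro t
    rw [← Set.injOn_univ, ← Finset.coe_univ, ← Finset.card_image_iff, hgupd_image,
      Finset.card_erase_of_mem (Finset.mem_of_mem_erase (hgmem t)), hH]
    simp
  have hrel : Ideal.Quotient.mk (pluckerIdeal (k + 1) n) (pluckerRelation f g 0) = 0 :=
    Ideal.Quotient.eq_zero_iff_mem.2 (Ideal.subset_span ⟨f, g, 0, rfl⟩)
  rw [pluckerRelation, map_sub, map_mul, map_sum, sub_eq_zero, mk_pluckerSymbol hfinj,
    mk_pluckerSymbol hginj, hgimage, hcons_image, hf0] at hrel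
  set s : Fin n → PluckerRing (k + 1) n := fun b =>
    (((-1 : ℤ) ^ (below F b + below H b) : ℤ) : PluckerRing (k + 1) n) with hs
  set P : Fin n → PluckerRing (k + 1) n := fun b =>
    coordOf (k + 1) (H.erase b) * coordOf (k + 1) (insert b F) with hP
  set E : PluckerRing (k + 1) n := ((seqSign f * seqSign g : ℤ) : PluckerRing (k + 1) n) with hE
  have hterm : ∀ t, Ideal.Quotient.mk (pluckerIdeal (k + 1) n)
      (pluckerSymbol (Function.update f 0 (g t)) * pluckerSymbol (Function.update g t b₀)) =
      if g t ∈ F then 0 else -(E * s b₀ * (s (g t) * P (g t))) := by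
    intro t
    obtain ⟨hne, hgtH⟩ := Finset.mem_erase.1 (hgmem t)
    rw [map_mul]
    by_cases hgt : g t ∈ F
    · rw [if_pos hgt, mk_pluckerSymbol_of_not_injective, zero_mul]
      rw [hupd, Fin.cons_injective_iff]
      rintro ⟨h1, -⟩
      refine h1 ?_
      rw [Finset.range_orderEmbOfFin]
      exact hgt
    · rw [if_neg hgt, mk_pluckerSymbol (hupd (g t) ▸ hcons_inj _ hgt),
        mk_pluckerSymbol (hgupd_inj t), hgupd_image, seqSign_update_eq hfinj hfF hgt,
        seqSign_update_eq hginj (hgH t) (by simp), hupd, hcons_image, hf0, hE, hs, hP]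
      have h1 := below_erase_erase hb₀H hgtH hne.symm
      have h2 : (-1 : ℤ) ^ (below F (g t) + below F b₀) *
          (-1) ^ (below ((H.erase b₀).erase (g t)) b₀ + below ((H.erase b₀).erase (g t)) (g t)) =
          -((-1) ^ (below F b₀ + below H b₀) * (-1) ^ (below F (g t) + below H (g t))) := by
        have h3 : (-1 : ℤ) ^ (below H b₀ + below H (g t)) = -(-1) ^
          (below ((H.erase b₀).erase (g t)) b₀ + below ((H.erase b₀).erase (g t)) (g t)) := by
          rw [← h1, pow_succ]
          ring
        rw [← neg_eq_iff_eq_neg] at h3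
        rw [← h3]
        ring
      have h4 := congrArg (Int.cast : ℤ → PluckerRing (k + 1) n) h2
      push_cast at h4 ⊢
      linear_combination (seqSign f * seqSign g : PluckerRing (k + 1) n) *
        coordOf (k + 1) (H.erase (g t)) * coordOf (k + 1) (insert (g t) F) * h4
  have hsum : ∑ t, Ideal.Quotient.mk (pluckerIdeal (k + 1) n)
      (pluckerSymbol (Function.update f 0 (g t)) * pluckerSymbol (Function.update g t b₀)) =
      -(E * s b₀ * ∑ b ∈ (H \ F).erase b₀, s b * P b) := by
    simp_rw [hterm]
    rw [← Finset.sum_image (f := fun b => if b ∈ F then 0 else -(E * s b₀ * (s b * P b)))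
      (fun _ _ _ _ h => hginj h), hgimage, Finset.sum_ite, Finset.sum_const_zero, zero_add,
      Finset.sum_neg_distrib, Finset.mul_sum]
    congr 1
    refine Finset.sum_congr ?_ fun _ _ => rfl
    ext b
    simp only [Finset.mem_filter, Finset.mem_erase, Finset.mem_sdiff]
    tauto
  rw [hsum] at hrel
  have hEE : E * E = 1 := by
    rw [hE, ← Int.cast_mul, mul_mul_mul_comm, seqSign_mul_self, seqSign_mul_self]
    simp
  have hss : ∀ b, s b * s b = 1 := by
    intro b
    rw [hs]
    dsimp only
    rw [← Int.cast_mul, ← mul_pow]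
    simp
  have hgoal : ∑ b ∈ H \ F, (-1 : ℤ) ^ (below F b + below H b) •
      (coordOf (k + 1) (H.erase b) * coordOf (k + 1) (insert b F)) = ∑ b ∈ H \ F, s b * P b :=
    Finset.sum_congr rfl fun b _ => zsmul_eq_mul _ _
  show ∑ b ∈ H \ F, (-1 : ℤ) ^ (below F b + below H b) •
      (coordOf (k + 1) (H.erase b) * coordOf (k + 1) (insert b F)) = 0
  rw [hgoal, ← Finset.add_sum_erase _ _ hb₀]
  have hrel' : E * P b₀ = -(E * s b₀ * ∑ b ∈ (H \ F).erase b₀, s b * P b) := by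
    rw [← hrel, hE, hP]
    push_cast
    ring
  set Q := ∑ b ∈ (H \ F).erase b₀, s b * P b
  linear_combination E * s b₀ * hrel' - s b₀ * P b₀ * hEE - Q * (s b₀ * s b₀ * hEE + hss b₀)

/-! ### The Plücker relations for compatibility sums -/

namespace PartialPairing

open Classical in
/-- For a fixed pairing, the terms of a Plücker relation cancel in pairs: an element `b` that may be
exchanged is joined by a strand to another such element `c`, the pairing is also compatible with the
term of `c`, and since the points between `b` and `c` are joined among themselves, the signs
differ. -/
lemma sum_sign_compatible_eq_zero (p : PartialPairing k n) (F H : Finset (Fin n))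
    (hF : F.card + 1 = k) (hH : H.card = k + 1) :
    ∑ b ∈ (H \ F).filter (fun b => H.erase b ∩ insert b F = p.marked ∧ ∀ s ∈ p.strands,
        (s.1 ∈ H.erase b ∧ s.2 ∈ insert b F) ∨ (s.1 ∈ insert b F ∧ s.2 ∈ H.erase b)),
      (-1 : ℤ) ^ (below F b + below H b) = 0 := by
  have hcards : ∀ b ∈ H \ F, (H.erase b).card = k ∧ (insert b F).card = k := by
    intro b hb
    obtain ⟨h1, h2⟩ := Finset.mem_sdiff.1 hb
    rw [Finset.card_erase_of_mem h1, Finset.card_insert_of_notMem h2]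
    exact ⟨by omega, hF⟩
  have hcomp : ∀ b (hb : b ∈ H \ F), (H.erase b ∩ insert b F = p.marked ∧ ∀ s ∈ p.strands,
      (s.1 ∈ H.erase b ∧ s.2 ∈ insert b F) ∨ (s.1 ∈ insert b F ∧ s.2 ∈ H.erase b)) ↔
      p.Compatible ⟨H.erase b, (hcards b hb).1⟩ ⟨insert b F, (hcards b hb).2⟩ :=
    fun b hb => Iff.rfl
  have hinter : ∀ b ∈ H \ F, H.erase b ∩ insert b F = H ∩ F := by
    intro b hb
    obtain ⟨h1, h2⟩ := Finset.mem_sdiff.1 hb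
    ext x
    simp only [Finset.mem_inter, Finset.mem_erase, Finset.mem_insert]
    have : x = b → x ∉ F := fun h => h ▸ h2
    tauto
  -- The partner of an exchangeable element.
  have hmate : ∀ b ∈ (H \ F).filter (fun b => H.erase b ∩ insert b F = p.marked ∧
      ∀ s ∈ p.strands, (s.1 ∈ H.erase b ∧ s.2 ∈ insert b F) ∨
        (s.1 ∈ insert b F ∧ s.2 ∈ H.erase b)),
      ∃ c ∈ (H \ F).filter (fun b => H.erase b ∩ insert b F = p.marked ∧
      ∀ s ∈ p.strands, (s.1 ∈ H.erase b ∧ s.2 ∈ insert b F) ∨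
        (s.1 ∈ insert b F ∧ s.2 ∈ H.erase b)), p.Joined b c ∧ c ≠ b := by
    intro b hb
    obtain ⟨hb, hbc⟩ := Finset.mem_filter.1 hb
    have hc := (hcomp b hb).1 hbc
    obtain ⟨hbH, hbF⟩ := Finset.mem_sdiff.1 hb
    have hbm : b ∉ p.marked := by
      rw [← hbc.1]
      simp
    obtain ⟨c, hcH, hjoin⟩ := hc.symm.exists_joined (Finset.mem_insert_self b F) hbm
    obtain ⟨hcb, hcH⟩ := Finset.mem_erase.1 hcH
    have hcF : c ∉ F := fun h => hjoin.symm.not_mem_marked (by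
      rw [← hbc.1]
      simp [hcb, hcH, h])
    have hcHF : c ∈ H \ F := Finset.mem_sdiff.2 ⟨hcH, hcF⟩
    refine ⟨c, Finset.mem_filter.2 ⟨hcHF, ?_, fun s hs => ?_⟩, hjoin, hcb⟩
    · rw [hinter c hcHF, ← hinter b hb, hbc.1]
    · by_cases h1 : p.Joined s.1 s.2 ∧ (s.1 = b ∨ s.2 = b)
      · rcases h1.2 with h2 | h2
        · have : s.2 = c := (h2 ▸ h1.1).unique hjoin
          left
          rw [h2, this]
          exact ⟨Finset.mem_erase.2 ⟨hcb.symm, hbH⟩, Finset.mem_insert_self _ _⟩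
        · have : s.1 = c := (h2 ▸ h1.1.symm).unique hjoin
          right
          rw [h2, this]
          exact ⟨Finset.mem_insert_self _ _, Finset.mem_erase.2 ⟨hcb.symm, hbH⟩⟩
      · have h2 : s.1 ≠ b ∧ s.2 ≠ b := by
          rw [← not_or]
          exact fun h => h1 ⟨Or.inl hs, h⟩
        have h3 : s.1 ≠ c ∧ s.2 ≠ c := by
          refine ⟨fun h => h2.2 ?_, fun h => h2.1 ?_⟩
          · exact Joined.unique (p := p) (x := c) (h ▸ Or.inl hs) hjoin.symm
          · exact Joined.unique (p := p) (x := c) (h ▸ Or.inr hs) hjoin.symm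
        have := hbc.2 s hs
        simp only [Finset.mem_erase, Finset.mem_insert] at this ⊢
        tauto
  -- Partners have opposite signs.
  have hsign : ∀ b ∈ (H \ F).filter (fun b => H.erase b ∩ insert b F = p.marked ∧
      ∀ s ∈ p.strands, (s.1 ∈ H.erase b ∧ s.2 ∈ insert b F) ∨
        (s.1 ∈ insert b F ∧ s.2 ∈ H.erase b)), ∀ c ∈ H \ F, (b, c) ∈ p.strands →
      (-1 : ℤ) ^ (below F b + below H b) + (-1) ^ (below F c + below H c) = 0 := by
    intro b hb c hcHF hs
    obtain ⟨hb, hbc⟩ := Finset.mem_filter.1 hb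
    have hc := (hcomp b hb).1 hbc
    obtain ⟨hbH, hbF⟩ := Finset.mem_sdiff.1 hb
    have hlt : b < c := p.strand_lt _ hs
    have hcount := hc.card_filter_eq (fun x => b < x ∧ x < c) (by
      rintro x y hxy ⟨hbx, hxc⟩
      have hyb : y ≠ b := by
        rintro rfl
        exact hxc.ne (hxy.symm.unique (Or.inl hs))
      have hyc : y ≠ c := by
        rintro rfl
        exact hbx.ne' (hxy.symm.unique (Or.inr hs))
      rcases hxy with hxy | hxy
      · have h1 := p.noncrossing _ hs _ hxy
        have h2 : x < y := p.strand_lt _ hxy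
        refine ⟨hbx.trans h2, ?_⟩
        by_contra h3
        exact h1 ⟨hbx, hxc, lt_of_le_of_ne (not_lt.1 h3) hyc.symm⟩
      · have h1 := p.noncrossing _ hxy _ hs
        have h2 : y < x := p.strand_lt _ hxy
        refine ⟨?_, h2.trans hxc⟩
        by_contra h3
        exact h1 ⟨lt_of_le_of_ne (not_lt.1 h3) hyb, hbx, hxc⟩)
    simp only at hcount
    have hsplit : ∀ G : Finset (Fin n), below G c =
        below G b + (if b ∈ G then 1 else 0) + (G.filter fun x => b < x ∧ x < c).card := by
      intro G
      have h1 : G.filter (· < c) = (G.filter (· < b) ∪ G.filter (· = b)) ∪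
          G.filter (fun x => b < x ∧ x < c) := by
        ext x
        simp only [Finset.mem_filter, Finset.mem_union]
        rcases lt_trichotomy x b with h | h | h
        · simp [h, h.ne, h.trans hlt, h.not_gt]
        · simp [h, hlt]
        · simp [h, h.ne', h.not_gt]
      rw [below, h1, Finset.card_union_of_disjoint, Finset.card_union_of_disjoint,
        Finset.filter_eq']
      · rw [below]
        split_ifs <;> simp
      · rw [Finset.disjoint_filter]
        rintro x - h1 h2
        exact h1.ne h2
      · rw [Finset.disjoint_union_left, Finset.disjoint_filter, Finset.disjoint_filter]
        refine ⟨?_, ?_⟩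
        · rintro x - h1 h2
          exact lt_asymm h1 h2.1
        · rintro x - h1 h2
          exact h2.1.ne' h1
    have h1 : (insert b F).filter (fun x => b < x ∧ x < c) =
        F.filter (fun x => b < x ∧ x < c) := by
      rw [Finset.filter_insert, if_neg fun h => lt_irrefl _ h.1]
    have h2 : (H.erase b).filter (fun x => b < x ∧ x < c) =
        H.filter (fun x => b < x ∧ x < c) := by
      rw [Finset.filter_erase, Finset.erase_eq_of_notMem]
      exact fun h => lt_irrefl _ (Finset.mem_filter.1 h).2.1
    rw [h1, h2] at hcount
    set N := (F.filter fun x => b < x ∧ x < c).card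
    rw [hsplit F, hsplit H, if_neg hbF, if_pos hbH, hcount,
      show below F b + 0 + N + (below H b + 1 + N) = below F b + below H b + 1 + 2 * N by ring,
      pow_add _ _ (2 * N), pow_mul, pow_succ]
    simp
  refine Finset.sum_involution (fun b hb => (hmate b hb).choose) ?_ ?_ ?_ ?_
  · intro b hb
    obtain ⟨hc, hjoin, -⟩ := (hmate b hb).choose_spec
    rcases hjoin with hs | hs
    · exact hsign b hb _ (Finset.mem_filter.1 hc).1 hs
    · rw [add_comm]
      exact hsign _ hc b (Finset.mem_filter.1 hb).1 hs
  · exact fun b hb _ => (hmate b hb).choose_spec.2.2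
  · exact fun b hb => (hmate b hb).choose_spec.1
  · intro b hb
    have h1 := (hmate b hb).choose_spec
    exact (hmate _ h1.1).choose_spec.2.1.unique h1.2.1.symm

end PartialPairing

open Classical in
/-- The sum of the values of `D` at the pairings compatible with `(I, J)`, for arbitrary sets. -/
noncomputable def compatibleSum {V : Type*} [AddCommMonoid V] (D : PartialPairing k n → V)
    (I J : Finset (Fin n)) : V :=
  ∑ p : PartialPairing k n with
    (I ∩ J = p.marked ∧ ∀ s ∈ p.strands, (s.1 ∈ I ∧ s.2 ∈ J) ∨ (s.1 ∈ J ∧ s.2 ∈ I)), D p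

lemma compatibleSum_val {V : Type*} [AddCommMonoid V] (D : PartialPairing k n → V)
    (I J : KSubset k n) :
    compatibleSum D I.1 J.1 = ∑ p : PartialPairing k n with p.Compatible I J, D p :=
  Finset.sum_congr (Finset.filter_congr fun _ _ => Iff.rfl) fun _ _ => rfl

lemma isPlucker_compatibleSum {V : Type*} [AddCommGroup V] (D : PartialPairing k n → V) :
    IsPlucker k (compatibleSum D) := by
  classical
  intro F H hF hH
  simp only [compatibleSum, Finset.smul_sum, Finset.sum_filter, smul_ite, smul_zero]
  rw [Finset.sum_comm]
  refine Finset.sum_eq_zero fun p _ => ?_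
  rw [← Finset.sum_filter, ← Finset.sum_smul, p.sum_sign_compatible_eq_zero F H hF hH, zero_smul]

lemma IsPlucker.sub {V : Type*} [AddCommGroup V] {Φ Ψ : Finset (Fin n) → Finset (Fin n) → V}
    (h : IsPlucker k Φ) (h' : IsPlucker k Ψ) : IsPlucker k fun I J => Φ I J - Ψ I J := by
  intro F H hF hH
  simp only [smul_sub, Finset.sum_sub_distrib, h F H hF hH, h' F H hF hH, sub_zero]

/-- A function that satisfies the Plücker relations and vanishes on standard pairs is zero. With
`T = I ∩ J`, `S` the symmetric difference and suitable signs, it is a function of the subset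
`I \ J` of `S` to which `eq_zero_of_eq_zero_on_ballot` applies. -/
lemma IsPlucker.eq_zero {V : Type*} [AddCommGroup V] [Module ℂ V]
    {Φ : Finset (Fin n) → Finset (Fin n) → V} (h : IsPlucker k Φ)
    (hst : ∀ I J : KSubset k n, IsStandard I J → Φ I.1 J.1 = 0) (I J : KSubset k n) :
    Φ I.1 J.1 = 0 := by
  set T := I.1 ∩ J.1 with hT
  set S := (I.1 ∪ J.1) \ T with hS
  set m := (I.1 \ J.1).card with hm
  have hTS : Disjoint T S := Finset.disjoint_sdiff
  have hTm : T.card + m = k := by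
    rw [hT, hm, add_comm, Finset.card_sdiff_add_card_inter, I.2]
  have hIS : I.1 \ J.1 ⊆ S := by
    intro x hx
    simp only [hS, hT, Finset.mem_sdiff, Finset.mem_union, Finset.mem_inter] at hx ⊢
    tauto
  have hSI : S \ (I.1 \ J.1) = J.1 \ I.1 := by
    ext x
    simp only [hS, hT, Finset.mem_sdiff, Finset.mem_union, Finset.mem_inter]
    tauto
  have hSm : S.card = 2 * m := by
    have h1 := Finset.card_sdiff_add_card_eq_card hIS
    rw [hSI] at h1
    have h2 := Finset.card_sdiff_add_card_inter J.1 I.1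
    rw [Finset.inter_comm, ← hT, J.2] at h2
    omega
  let η : Fin n → ℤ := fun b => (-1) ^ below S b
  let ψ : Finset (Fin n) → V := fun A => (∏ a ∈ A, η a) • Φ (T ∪ A) (T ∪ (S \ A))
  have hη : ∀ b, η b * η b = 1 := by
    intro b
    show (-1 : ℤ) ^ below S b * (-1) ^ below S b = 1
    rw [← mul_pow]
    simp
  have hdisj : ∀ A ⊆ S, Disjoint T A := fun A hA => hTS.mono_right hA
  have hψ : ∀ B ⊆ S, B.card = m + 1 → ∑ b ∈ B, ψ (B.erase b) = 0 := by
    intro B hB hBcard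
    have hcard1 : (T ∪ (S \ B)).card + 1 = k := by
      rw [Finset.card_union_of_disjoint (hdisj _ Finset.sdiff_subset),
        Finset.card_sdiff_of_subset hB]
      have := Finset.card_le_card hB
      omega
    have hcard2 : (T ∪ B).card = k + 1 := by
      rw [Finset.card_union_of_disjoint (hdisj _ hB)]
      omega
    have hrel := h _ _ hcard1 hcard2
    have hBF : (T ∪ B) \ (T ∪ (S \ B)) = B := by
      ext x
      have h1 : x ∈ B → x ∉ T := fun hx hxT => Finset.disjoint_left.1 (hdisj _ hB) hxT hx
      simp only [Finset.mem_sdiff, Finset.mem_union]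
      tauto
    rw [hBF] at hrel
    have hterm : ∀ b ∈ B, ψ (B.erase b) = (∏ a ∈ B, η a) •
        ((-1 : ℤ) ^ (below (T ∪ (S \ B)) b + below (T ∪ B) b) •
          Φ ((T ∪ B).erase b) (insert b (T ∪ (S \ B)))) := by
      intro b hb
      have hbT : b ∉ T := fun hbT => Finset.disjoint_left.1 (hdisj _ hB) hbT hb
      have h1 : (T ∪ B).erase b = T ∪ B.erase b := by
        rw [Finset.erase_union_distrib, Finset.erase_eq_of_notMem hbT]
      have h2 : insert b (T ∪ (S \ B)) = T ∪ (S \ B.erase b) := by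
        rw [Finset.sdiff_erase (hB hb), Finset.union_insert]
      have h3 : below S b = below B b + below (S \ B) b := by
        rw [← below_union Finset.disjoint_sdiff, Finset.union_sdiff_of_subset hB]
      have h4 : (-1 : ℤ) ^ (below (T ∪ (S \ B)) b + below (T ∪ B) b) = η b := by
        rw [below_union (hdisj _ Finset.sdiff_subset), below_union (hdisj _ hB)]
        show _ = (-1 : ℤ) ^ below S b
        rw [h3, show below T b + below (S \ B) b + (below T b + below B b) =
          2 * below T b + (below B b + below (S \ B) b) by ring, pow_add, pow_mul]
        simp
      rw [h1, h2, h4, smul_smul, ← Finset.mul_prod_erase B η hb, mul_comm (η b), mul_assoc, hη,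
        mul_one]
    rw [Finset.sum_congr rfl hterm, ← Finset.smul_sum, hrel, smul_zero]
  have hball : ∀ A ⊆ S, A.card = m →
      (∀ x, ((S \ A).filter (· ≤ x)).card ≤ (A.filter (· ≤ x)).card) → ψ A = 0 := by
    intro A hA hAcard hb
    have h1 : (T ∪ A).card = k := by
      rw [Finset.card_union_of_disjoint (hdisj _ hA), hAcard, hTm]
    have h2 : (T ∪ (S \ A)).card = k := by
      rw [Finset.card_union_of_disjoint (hdisj _ Finset.sdiff_subset),
        Finset.card_sdiff_of_subset hA]
      omega
    have h3 : IsStandard (⟨_, h1⟩ : KSubset k n) ⟨_, h2⟩ := by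
      rw [isStandard_iff]
      intro x
      dsimp only
      rw [Finset.filter_union, Finset.filter_union, Finset.card_union_of_disjoint
        (Finset.disjoint_filter_filter (hdisj _ Finset.sdiff_subset)),
        Finset.card_union_of_disjoint (Finset.disjoint_filter_filter (hdisj _ hA))]
      exact Nat.add_le_add_left (hb x) _
    show (∏ a ∈ A, η a) • Φ (T ∪ A) (T ∪ (S \ A)) = 0
    rw [hst _ _ h3, smul_zero]
  have hzero : ψ (I.1 \ J.1) = 0 := eq_zero_of_eq_zero_on_ballot hψ hball hIS rfl
  have h1 : T ∪ (I.1 \ J.1) = I.1 := by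
    rw [hT, Finset.union_comm, Finset.sdiff_union_inter]
  have h2 : T ∪ (S \ (I.1 \ J.1)) = J.1 := by
    rw [hSI, hT, Finset.union_comm, Finset.inter_comm, Finset.sdiff_union_inter]
  have h3 : (∏ a ∈ I.1 \ J.1, η a) • Φ I.1 J.1 = 0 := by
    have : (∏ a ∈ I.1 \ J.1, η a) • Φ (T ∪ (I.1 \ J.1)) (T ∪ (S \ (I.1 \ J.1))) = 0 := hzero
    rwa [h1, h2] at this
  have h4 : (∏ a ∈ I.1 \ J.1, η a) * (∏ a ∈ I.1 \ J.1, η a) = 1 := by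
    rw [← Finset.prod_mul_distrib]
    exact Finset.prod_eq_one fun b _ => hη b
  calc Φ I.1 J.1 = ((∏ a ∈ I.1 \ J.1, η a) * (∏ a ∈ I.1 \ J.1, η a)) • Φ I.1 J.1 := by
        rw [h4, one_smul]
    _ = 0 := by rw [mul_smul, h3, smul_zero]

/-! ### Existence, uniqueness and the formula -/

open Classical in
/-- The relation `sum_compatible_signedPathCount` with the two matrices multiplied in the other
order; both matrices are square, since standard pairs correspond to pairings under `θ`. -/
lemma sum_signedPathCount_compatible (p q : PartialPairing k n) :
    ∑ r : PartialPairing k n with q.Compatible r.theta.1 r.theta.2,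
      signedPathCount r.theta p.theta = if q = p then 1 else 0 := by
  let M : Matrix (PartialPairing k n) (PartialPairing k n) ℤ :=
    Matrix.of fun p r => if p.Compatible r.theta.1 r.theta.2 then 1 else 0
  let C : Matrix (PartialPairing k n) (PartialPairing k n) ℤ :=
    Matrix.of fun r p => signedPathCount r.theta p.theta
  have h1 : C * M = 1 := by
    ext r s
    rw [Matrix.mul_apply, Matrix.one_apply]
    have := sum_compatible_signedPathCount (A := s.theta) (B := r.theta) s.isStandard_theta
      r.isStandard_theta
    rw [Finset.sum_filter] at this
    simp only [M, C, Matrix.of_apply, mul_ite, mul_one, mul_zero]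
    rw [this]
    exact if_congr ⟨fun h => (PartialPairing.theta_injective h).symm, fun h => h ▸ rfl⟩ rfl rfl
  have h2 : M * C = 1 := mul_eq_one_comm.1 h1
  have h3 := congrFun (congrFun h2 q) p
  rw [Matrix.mul_apply, Matrix.one_apply] at h3
  simp only [M, C, Matrix.of_apply, ite_mul, one_mul, zero_mul] at h3
  rw [Finset.sum_filter, h3]

lemma sum_standard_eq_sum_theta {V : Type*} [AddCommMonoid V]
    (f : KSubset k n × KSubset k n → V) :
    ∑ A : KSubset k n × KSubset k n with IsStandard A.1 A.2, f A =
      ∑ r : PartialPairing k n, f r.theta := by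
  symm
  refine Finset.sum_bij (fun r _ => r.theta) (fun r _ => ?_)
    (fun r _ s _ h => PartialPairing.theta_injective h) (fun A hA => ?_) fun _ _ => rfl
  · exact Finset.mem_filter.2 ⟨Finset.mem_univ _, r.isStandard_theta⟩
  · obtain ⟨r, hr⟩ := PartialPairing.exists_theta_eq (Finset.mem_filter.1 hA).2
    exact ⟨r, Finset.mem_univ r, hr⟩

/-- The Temperley–Lieb identities for standard pairs can be inverted. -/
lemma IsTemperleyLieb.eq_sum {D : PartialPairing k n → PluckerRing k n} (hD : IsTemperleyLieb D)
    (p : PartialPairing k n) :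
    D p = ∑ A : KSubset k n × KSubset k n with IsStandard A.1 A.2,
      signedPathCount A p.theta • (pluckerCoord A.1 * pluckerCoord A.2) := by
  classical
  rw [sum_standard_eq_sum_theta fun A =>
    signedPathCount A p.theta • (pluckerCoord A.1 * pluckerCoord A.2)]
  simp only [hD.2, Finset.smul_sum, Finset.sum_filter]
  rw [Finset.sum_comm]
  have h : ∀ q : PartialPairing k n, (∑ r : PartialPairing k n,
      signedPathCount r.theta p.theta • if q.Compatible r.theta.1 r.theta.2 then D q else 0) =
      if q = p then D q else 0 := by
    intro q
    have := congrArg (· • D q) (sum_signedPathCount_compatible p q)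
    simp only [Finset.sum_smul, ite_smul, one_smul, zero_smul, Finset.sum_filter] at this
    simpa only [smul_ite, smul_zero] using this
  rw [Finset.sum_congr rfl fun q _ => h q]
  simp

/-- For standard pairs, the elements given by the signed path counts satisfy the Temperley–Lieb
identities. -/
lemma sum_compatible_sum_signedPathCount {V : Type*} [AddCommGroup V]
    (f : KSubset k n × KSubset k n → V) {A : KSubset k n × KSubset k n}
    (hA : IsStandard A.1 A.2) :
    ∑ p : PartialPairing k n with p.Compatible A.1 A.2,
      ∑ B : KSubset k n × KSubset k n with IsStandard B.1 B.2, signedPathCount B p.theta • f B =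
      f A := by
  classical
  rw [Finset.sum_comm, Finset.sum_eq_single_of_mem A (by simpa using hA)]
  · rw [← Finset.sum_smul, sum_compatible_signedPathCount hA hA, if_pos rfl, one_smul]
  · intro B hB hne
    rw [← Finset.sum_smul, sum_compatible_signedPathCount hA (Finset.mem_filter.1 hB).2,
      if_neg hne.symm, zero_smul]

end

theorem theorem3 (k n : ℕ) :
    (∃! D : PartialPairing k n → PluckerRing k n, IsTemperleyLieb D) ∧
    ∀ D : PartialPairing k n → PluckerRing k n, IsTemperleyLieb D →
      ∀ p : PartialPairing k n,
        D p = ∑ A : KSubset k n × KSubset k n with IsStandard A.1 A.2,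
          signedPathCount A p.theta • (pluckerCoord A.1 * pluckerCoord A.2) := by
  refine ⟨?_, fun D hD p => hD.eq_sum p⟩
  let D : PartialPairing k n → PluckerRing k n := fun p =>
    ∑ A : KSubset k n × KSubset k n with IsStandard A.1 A.2,
      signedPathCount A p.theta • (pluckerCoord A.1 * pluckerCoord A.2)
  refine ⟨D, ⟨fun p => ?_, fun I J => ?_⟩, fun D' hD' => funext fun p => hD'.eq_sum p⟩
  · refine Submodule.sum_mem _ fun A _ => ?_
    have hA : pluckerCoord A.1 * pluckerCoord A.2 ∈ pluckerDegreeTwo k n :=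
      Submodule.subset_span ⟨A.1, A.2, rfl⟩
    exact zsmul_mem hA _
  · have hzero := (isPlucker_coordOf.sub (isPlucker_compatibleSum D)).eq_zero
      (fun I J hIJ => by
        rw [coordOf_val, coordOf_val, compatibleSum_val, sub_eq_zero]
        exact (sum_compatible_sum_signedPathCount
          (fun A : KSubset k n × KSubset k n => pluckerCoord A.1 * pluckerCoord A.2)
          (A := (I, J)) hIJ).symm) I J
    rwa [coordOf_val, coordOf_val, compatibleSum_val, sub_eq_zero] at hzero
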